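/- Let $M\ge 1$, let $R$ be a positive definite Hermitian $M\times M$ matrix, and let $c>0$. Write $\mathbb{C}^+=\{z:\mathrm{Im}\,z>0\}$. For each $z\in\mathbb{C}^+$ there is a unique $t(z)$ with $t(z)\in\mathbb{C}^+$, $z\,t(z)\in\mathbb{C}^+$ and $$t(z)=\frac1M\,\mathrm{Tr}\,R\left(-zI_M-\frac{z\,c\,t(z)}{1-z\,c^2\,t(z)^2}\,R\right)^{-1}.$$ The function $t$ is the Stieltjes transform $t(z)=\int(\lambda-z)^{-1}\,d\mu(\lambda)$ of a finite positive measure $\mu$ carried by $[0,\infty)$. For every $x>0$ the limit $t(x)=\lim_{z\to x,\,z\in\mathbb{C}^+}t(z)$ exists, the function $f(x)=\frac1\pi\,\mathrm{Im}\,t(x)$ is continuous on $(0,\infty)$, and $f$ is the density of $\mu$ on $(0,\infty)$ with respect to Lebesgue measure. If $x_0>0$ and $\mathrm{Im}\,t(x_0)>0$, then $t$ and $f$ have convergent power series expansions around $x_0$: there are complex numbers $(a_k)_{k\ge0}$, real numbers $(b_k)_{k\ge0}$ and $\varepsilon>0$ such that, for all real $x$ with $|x-x_0|<\varepsilon$,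 $$t(x)=\sum_{k=0}^{\infty}a_k(x-x_0)^k,\qquad f(x)=\sum_{k=0}^{\infty}b_k(x-x_0)^k.$$ Hence $f$ is real analytic on $U=\{x>0:\mathrm{Im}\,t(x)>0\}$. Moreover $U$ is the set of those points of the interior of the support of $\mu$ at which $f$ does not vanish, and $U$ is dense in that interior. -/

import Mathlib

open MeasureTheory Filter Topology Set
open scoped ComplexOrder

noncomputable section

/-- `s` solves the canonical equation
`s = (1/M) Tr R (-z I - (z c s / (1 - z c² s²)) R)⁻¹` at the point `z`, subject to `s ∈ ℂ⁺` and
`z s ∈ ℂ⁺`. (For `z ∈ ℂ⁺` the two sign conditions force `1 - z c² s² ≠ 0`, and the equation with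
`Im s > 0` forces the matrix to be invertible.) -/
def IsCanonicalSolution {M : ℕ} (R : Matrix (Fin M) (Fin M) ℂ) (c : ℝ) (z s : ℂ) : Prop :=
  0 < s.im ∧ 0 < (z * s).im ∧
    s = (1 / (M : ℂ)) *
      (R * (-(z • (1 : Matrix (Fin M) (Fin M) ℂ)) -
        (z * c * s / (1 - z * (c : ℂ) ^ 2 * s ^ 2)) • R)⁻¹).trace

open Classical in
/-- The function `t` on the open upper half-plane: `t(z)` is the solution of the canonical
equation at `z`. -/
def canonicalT {M : ℕ} (R : Matrix (Fin M) (Fin M) ℂ) (c : ℝ) (z : ℂ) : ℂ :=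
  if h : ∃ s : ℂ, IsCanonicalSolution R c z s then h.choose else 0

/-- `μ` is a finite positive measure carried by `[0, ∞)` whose Stieltjes transform
`z ↦ ∫ (l - z)⁻¹ dμ(l)` coincides with `g` on the open upper half-plane. -/
def IsStieltjesMeasure (μ : Measure ℝ) (g : ℂ → ℂ) : Prop :=
  IsFiniteMeasure μ ∧ μ (Iio 0) = 0 ∧ ∀ z : ℂ, 0 < z.im → resolventTransform μ z = g z

open Classical in
/-- The measure `μ` whose Stieltjes transform is `t`. -/
def canonicalMeasure {M : ℕ} (R : Matrix (Fin M) (Fin M) ℂ) (c : ℝ) : Measure ℝ :=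
  if h : ∃ μ : Measure ℝ, IsStieltjesMeasure μ (canonicalT R c) then h.choose else 0

/-- The boundary value `t(x) = lim_{z → x, z ∈ ℂ⁺} t(z)` at a real point `x`. -/
def boundaryT {M : ℕ} (R : Matrix (Fin M) (Fin M) ℂ) (c : ℝ) (x : ℝ) : ℂ :=
  limUnder (𝓝[{z : ℂ | 0 < z.im}] (x : ℂ)) (canonicalT R c)

/-- The function `f(x) = (1/π) Im t(x)`. -/
def densityF {M : ℕ} (R : Matrix (Fin M) (Fin M) ℂ) (c : ℝ) (x : ℝ) : ℝ :=
  (1 / Real.pi) * (boundaryT R c x).im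

/-- The set of the points `x > 0` at which `Im t(x) > 0`. -/
def bulkSet {M : ℕ} (R : Matrix (Fin M) (Fin M) ℂ) (c : ℝ) : Set ℝ :=
  {x : ℝ | 0 < x ∧ 0 < (boundaryT R c x).im}

end

/-!
Let `G(u)` be the mean of `λ / (1 + u λ)` over the eigenvalues `λ` of `R`. With
`u = c t / (1 - z c² t²)`, the canonical equation becomes the pair `z t = -G(u)` and
`u⁻¹ = (c t)⁻¹ - c z t`, and it defines a curve parametrized by `u`, on which
`z = Z(u) = -c G(u) (1 - c u G(u)) / u`.

The imaginary parts of the two equations form a linear system with positive coefficients. That its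
solution `(Im (z t), Im t)` is positive bounds
`B(u) |u|² (c + 1 / (c |z| |t|²))` by `1`, strictly when `Im z > 0`, where `B(u)` is the mean of
`λ² / |1 + u λ|²`. By the Cauchy-Schwarz inequality, two solutions at the same `z` coincide, and
`Z'(u) ≠ 0`, also at real `z`, so that solutions continue analytically. The same bound keeps `u` in
a compact set as long as `z` stays near a nonzero point; hence the set of the `z ∈ ℂ⁺` with a
solution is open and closed in `ℂ⁺`. It is nonempty since `Z(i ε)` lies in `ℂ⁺` for small `ε`.

The function `t` is analytic with positive imaginary part and `y t(i y)` is bounded as `y → ∞`, so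
it is the Stieltjes transform of a finite measure, by the Herglotz representation on the disc and
the Cayley transform. As `z ∈ ℂ⁺` tends to a real `x ≠ 0`, the cluster points of `u(z)` are zeros of
`Z - x`, hence isolated, and they form a connected set: `u`, and with it `t`, has a limit. Stieltjes
inversion then gives the density, and where `Im t(x) > 0` the boundary point is again on the curve,
so that `t` continues analytically across `x`.
-/

noncomputable section

local notation "ℂ⁺" => Set.ofPred fun z : ℂ => 0 < Complex.im z

/-! ### Stieltjes inversion -/

section StieltjesInversion

variable {μ : Measure ℝ}

lemma resolvent_ofReal (z : ℂ) (l : ℝ) : resolvent z l = ((l : ℂ) - z)⁻¹ :=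
  Ring.inverse_eq_inv _

lemma im_resolvent (x y l : ℝ) :
    (resolvent ((x : ℂ) + y * Complex.I) l).im = y / ((l - x) ^ 2 + y ^ 2) := by
  simp only [resolvent_ofReal, Complex.inv_im, Complex.normSq_apply]
  simp
  ring

lemma norm_resolvent_le {z : ℂ} (hz : 0 < z.im) (l : ℝ) : ‖resolvent z l‖ ≤ 1 / z.im := by
  rw [resolvent_ofReal, norm_inv, one_div]
  refine inv_anti₀ hz ?_
  simpa [abs_of_pos hz] using Complex.abs_im_le_norm ((l : ℂ) - z)

lemma notMem_ofReal_image_of_im_pos {z : ℂ} (hz : 0 < z.im) (s : Set ℝ) :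
    z ∉ algebraMap ℝ ℂ '' s := by
  rintro ⟨x, -, rfl⟩
  simp at hz

lemma integrable_resolvent_of_im_pos [IsFiniteMeasure μ] {z : ℂ} (hz : 0 < z.im) :
    Integrable (fun l : ℝ => resolvent z l) μ :=
  integrable_resolvent (notMem_ofReal_image_of_im_pos hz _)

lemma im_resolventTransform [IsFiniteMeasure μ] (x : ℝ) {y : ℝ} (hy : 0 < y) :
    (resolventTransform μ ((x : ℂ) + y * Complex.I)).im = ∫ l, y / ((l - x) ^ 2 + y ^ 2) ∂μ := by
  have hint : Integrable (fun l : ℝ => resolvent ((x : ℂ) + y * Complex.I) l) μ :=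
    integrable_resolvent_of_im_pos (by simpa using hy)
  simpa only [resolventTransform_apply, Complex.imCLM_apply, im_resolvent] using
    (Complex.imCLM.integral_comp_comm hint).symm

lemma im_resolventTransform_nonneg [IsFiniteMeasure μ] {z : ℂ} (hz : 0 < z.im) :
    0 ≤ (resolventTransform μ z).im := by
  rw [← Complex.re_add_im z, im_resolventTransform _ hz]
  exact integral_nonneg fun l => by positivity

lemma norm_poisson_le {y : ℝ} (hy : 0 < y) (x l : ℝ) :
    ‖y / ((l - x) ^ 2 + y ^ 2)‖ ≤ 1 / y := by
  rw [Real.norm_eq_abs, abs_of_nonneg (by positivity), div_le_div_iff₀ (by positivity) hy]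
  nlinarith [sq_nonneg (l - x)]

lemma continuous_poisson {y : ℝ} (hy : 0 < y) :
    Continuous fun p : ℝ × ℝ => y / ((p.2 - p.1) ^ 2 + y ^ 2) :=
  continuous_const.div (by fun_prop) fun p => by positivity

lemma intervalIntegral_poisson {y : ℝ} (hy : 0 < y) (a b l : ℝ) :
    ∫ x in a..b, y / ((l - x) ^ 2 + y ^ 2) =
      Real.arctan ((b - l) / y) - Real.arctan ((a - l) / y) := by
  refine intervalIntegral.integral_eq_sub_of_hasDerivAt
    (f := fun x => Real.arctan ((x - l) / y)) (fun x _ => ?_)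
    (((continuous_poisson hy).comp (.prodMk_left l)).intervalIntegrable _ _)
  have hlin : HasDerivAt (fun x => (x - l) / y) (1 / y) x :=
    ((hasDerivAt_id x).sub_const l).div_const y
  convert! hlin.arctan using 1
  field_simp
  ring

lemma intervalIntegral_im_resolventTransform [IsFiniteMeasure μ] {a b y : ℝ} (hab : a ≤ b)
    (hy : 0 < y) :
    ∫ x in a..b, (resolventTransform μ ((x : ℂ) + y * Complex.I)).im =
      ∫ l, (Real.arctan ((b - l) / y) - Real.arctan ((a - l) / y)) ∂μ := by
  simp_rw [im_resolventTransform _ hy, ← intervalIntegral_poisson hy,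
    intervalIntegral.integral_of_le hab]
  exact integral_integral_swap <| .of_bound (continuous_poisson hy).aestronglyMeasurable (1 / y)
    (ae_of_all _ fun p => norm_poisson_le hy p.1 p.2)

lemma tendsto_arctan_div_nhdsGT_zero (t : ℝ) :
    Tendsto (fun y : ℝ => Real.arctan (t / y)) (𝓝[>] 0) (𝓝 (Real.pi / 2 * SignType.sign t)) := by
  simp_rw [div_eq_mul_inv t]
  rcases lt_trichotomy t 0 with ht | rfl | ht
  · simpa [sign_neg ht, Function.comp_def] using
      (tendsto_nhds_of_tendsto_nhdsWithin Real.tendsto_arctan_atBot).comp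
        (tendsto_inv_nhdsGT_zero.const_mul_atTop_of_neg ht)
  · simp
  · simpa [sign_pos ht, Function.comp_def] using
      (tendsto_nhds_of_tendsto_nhdsWithin Real.tendsto_arctan_atTop).comp
        (tendsto_inv_nhdsGT_zero.const_mul_atTop ht)

lemma half_pi_mul_sign_sub_sign {a b : ℝ} (hab : a < b) (l : ℝ) :
    Real.pi / 2 * SignType.sign (b - l) - Real.pi / 2 * SignType.sign (a - l) =
      (Ioo a b).indicator (fun _ => Real.pi) l +
        (({a} : Set ℝ).indicator (fun _ => Real.pi / 2) l +
          ({b} : Set ℝ).indicator (fun _ => Real.pi / 2) l) := by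
  rcases lt_trichotomy l a with hla | rfl | hal
  · have hlb : l < b := hla.trans hab
    simp [sign_pos (sub_pos.2 hla), sign_pos (sub_pos.2 hlb), hla.ne, hlb.ne, hla.not_gt]
  · simp [sign_pos (sub_pos.2 hab), hab.ne]
  · rcases lt_trichotomy l b with hlb | rfl | hbl
    · simp [sign_neg (sub_neg.2 hal), sign_pos (sub_pos.2 hlb), hal.ne', hlb.ne, hal, hlb]
    · simp [sign_neg (sub_neg.2 hal), hal.ne']
    · simp [sign_neg (sub_neg.2 hal), sign_neg (sub_neg.2 hbl), hal.ne', hbl.ne', hbl.not_gt]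

lemma integral_half_pi_mul_sign_sub_sign [IsFiniteMeasure μ] {a b : ℝ} (hab : a < b) :
    ∫ l, (Real.pi / 2 * SignType.sign (b - l) - Real.pi / 2 * SignType.sign (a - l)) ∂μ =
      Real.pi * (μ.real (Ioo a b) + (μ.real {a} + μ.real {b}) / 2) := by
  have hint {s : Set ℝ} (hs : MeasurableSet s) (r : ℝ) :
      Integrable (s.indicator fun _ => r) μ := (integrable_const r).indicator hs
  simp_rw [half_pi_mul_sign_sub_sign hab]
  rw [integral_add (hint measurableSet_Ioo _) ((hint (.singleton a) _).fun_add
      (hint (.singleton b) _)), integral_add (hint (.singleton a) _) (hint (.singleton b) _),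
    integral_indicator_const _ measurableSet_Ioo, integral_indicator_const _ (.singleton a),
    integral_indicator_const _ (.singleton b)]
  simp only [smul_eq_mul]
  ring

theorem tendsto_intervalIntegral_im_resolventTransform [IsFiniteMeasure μ] {a b : ℝ}
    (hab : a < b) :
    Tendsto (fun y : ℝ => ∫ x in a..b, (resolventTransform μ ((x : ℂ) + y * Complex.I)).im)
      (𝓝[>] 0) (𝓝 (Real.pi * (μ.real (Ioo a b) + (μ.real {a} + μ.real {b}) / 2))) := by
  rw [← integral_half_pi_mul_sign_sub_sign hab]
  refine Tendsto.congr' (eventually_mem_nhdsWithin.mono fun y hy =>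
    (intervalIntegral_im_resolventTransform hab.le hy).symm) ?_
  refine tendsto_integral_filter_of_dominated_convergence (fun _ => Real.pi) ?_ ?_
    (integrable_const _) (ae_of_all _ fun l =>
      (tendsto_arctan_div_nhdsGT_zero _).sub (tendsto_arctan_div_nhdsGT_zero _))
  · refine Eventually.of_forall fun y => Measurable.aestronglyMeasurable ?_
    exact (Real.measurable_arctan.comp (by fun_prop)).sub
      (Real.measurable_arctan.comp (by fun_prop))
  · refine Eventually.of_forall fun y => ae_of_all _ fun l => ?_
    rw [Real.norm_eq_abs, abs_le]
    constructor <;>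
    linarith [Real.arctan_lt_pi_div_two ((b - l) / y), Real.neg_pi_div_two_lt_arctan ((b - l) / y),
      Real.arctan_lt_pi_div_two ((a - l) / y), Real.neg_pi_div_two_lt_arctan ((a - l) / y)]

lemma measureReal_singleton_le_mul_im_resolventTransform [IsFiniteMeasure μ] (x : ℝ) {y : ℝ}
    (hy : 0 < y) :
    μ.real {x} ≤ y * (resolventTransform μ ((x : ℂ) + y * Complex.I)).im := by
  have hint : Integrable (fun l => y / ((l - x) ^ 2 + y ^ 2)) μ :=
    .of_bound ((continuous_poisson hy).comp (.prodMk_right x)).aestronglyMeasurable (1 / y)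
      (ae_of_all _ fun l => norm_poisson_le hy x l)
  rw [im_resolventTransform x hy, ← integral_const_mul, ← mul_one (μ.real _), ← smul_eq_mul,
    ← integral_indicator_const _ (.singleton x)]
  refine integral_mono ((integrable_const _).indicator (.singleton x)) (hint.const_mul y)
    fun l => ?_
  by_cases hl : l = x
  · subst hl
    simp [field]
  · simp only [mem_singleton_iff, hl, not_false_eq_true, indicator_of_notMem]
    positivity

lemma ofReal_mem_closure_upperHalfPlane (x : ℝ) : (x : ℂ) ∈ closure ℂ⁺ := by
  simp [Complex.closure_setOfPred_lt_im]

instance nhdsWithin_upperHalfPlane_neBot (x : ℝ) : (𝓝[ℂ⁺] (x : ℂ)).NeBot :=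
  mem_closure_iff_nhdsWithin_neBot.1 (ofReal_mem_closure_upperHalfPlane x)

lemma tendsto_add_mul_I_nhdsWithin (x : ℝ) :
    Tendsto (fun y : ℝ => (x : ℂ) + y * Complex.I) (𝓝[>] 0) (𝓝[ℂ⁺] (x : ℂ)) := by
  refine tendsto_nhdsWithin_iff.2 ⟨?_, eventually_mem_nhdsWithin.mono fun y hy => by simpa using hy⟩
  refine tendsto_nhdsWithin_of_tendsto_nhds (Continuous.tendsto' ?_ _ _ (by simp))
  fun_prop

lemma continuousOn_of_tendsto_upperHalfPlane {E : Type*} [TopologicalSpace E] [T3Space E]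
    {F : ℂ → E} {g : ℝ → E} {U : Set ℝ}
    (hlim : ∀ x ∈ U, Tendsto F (𝓝[ℂ⁺] (x : ℂ)) (𝓝 (g x))) : ContinuousOn g U := by
  have hext : ContinuousOn (extendFrom ℂ⁺ F) (Complex.ofReal '' U) :=
    continuousOn_extendFrom (image_subset_iff.2 fun x _ => ofReal_mem_closure_upperHalfPlane x)
      (forall_mem_image.2 fun x hx => ⟨g x, hlim x hx⟩)
  refine (hext.comp Complex.continuous_ofReal.continuousOn (mapsTo_image _ U)).congr fun x hx => ?_
  exact (extendFrom_eq (ofReal_mem_closure_upperHalfPlane x) (hlim x hx)).symm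

lemma exists_ball_norm_le_of_tendsto {F : ℂ → ℝ} {x w : ℝ}
    (hlim : Tendsto F (𝓝[ℂ⁺] (x : ℂ)) (𝓝 w)) :
    ∃ δ > 0, ∀ s ∈ Ioo (x - δ) (x + δ), ∀ y ∈ Ioo 0 δ,
      ‖F ((s : ℂ) + y * Complex.I)‖ ≤ ‖w‖ + 1 := by
  have hev : ∀ᶠ z in 𝓝[ℂ⁺] (x : ℂ), ‖F z‖ < ‖w‖ + 1 :=
    hlim.norm.eventually_lt_const (lt_add_one _)
  obtain ⟨δ, hδ, hball⟩ := Metric.mem_nhdsWithin_iff.1 hev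
  refine ⟨δ / 2, half_pos hδ, fun s hs y hy => (hball ⟨?_, by simpa using hy.1⟩).le⟩
  have hdist : ‖((s - x : ℝ) : ℂ) + (y : ℝ) * Complex.I‖ ≤ |s - x| + |y| := by
    refine (norm_add_le _ _).trans_eq ?_
    simp only [norm_mul, Complex.norm_real, Complex.norm_I, mul_one, Real.norm_eq_abs]
  have hsx : |s - x| < δ / 2 := abs_lt.2 ⟨by linarith [hs.1], by linarith [hs.2]⟩
  have hy' : |y| < δ / 2 := by rw [abs_of_pos hy.1]; exact hy.2
  rw [mem_ball_iff_norm, show (s : ℂ) + y * Complex.I - x = ((s - x : ℝ) : ℂ) + y * Complex.I by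
    push_cast; ring]
  linarith

lemma measureReal_singleton_eq_zero_of_tendsto [IsFiniteMeasure μ] {x w : ℝ}
    (hlim : Tendsto (fun z => (resolventTransform μ z).im) (𝓝[ℂ⁺] (x : ℂ)) (𝓝 w)) :
    μ.real {x} = 0 := by
  refine le_antisymm (ge_of_tendsto (x := 𝓝[>] (0 : ℝ)) ?_ <| eventually_mem_nhdsWithin.mono
    fun y hy => measureReal_singleton_le_mul_im_resolventTransform x hy) measureReal_nonneg
  simpa using (tendsto_id.mono_left nhdsWithin_le_nhds).mul
    (hlim.comp (tendsto_add_mul_I_nhdsWithin x))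

lemma intervalIntegral_eq_pi_mul_measureReal_Ioo [IsFiniteMeasure μ] {g : ℝ → ℝ} {a b C δ : ℝ}
    (hab : a < b) (hδ : 0 < δ)
    (hlim : ∀ x ∈ Icc a b,
      Tendsto (fun z => (resolventTransform μ z).im) (𝓝[ℂ⁺] (x : ℂ)) (𝓝 (g x)))
    (hbound : ∀ x ∈ Icc a b, ∀ y ∈ Ioo 0 δ,
      ‖(resolventTransform μ ((x : ℂ) + y * Complex.I)).im‖ ≤ C) :
    ∫ x in a..b, g x = Real.pi * μ.real (Ioo a b) := by
  have hsub : uIoc a b ⊆ Icc a b := uIoc_of_le hab.le ▸ Ioc_subset_Icc_self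
  have hinv := tendsto_intervalIntegral_im_resolventTransform (μ := μ) hab
  simp only [measureReal_singleton_eq_zero_of_tendsto (hlim a (left_mem_Icc.2 hab.le)),
    measureReal_singleton_eq_zero_of_tendsto (hlim b (right_mem_Icc.2 hab.le)), add_zero,
    zero_div] at hinv
  refine tendsto_nhds_unique ?_ hinv
  refine intervalIntegral.tendsto_integral_filter_of_dominated_convergence (fun _ => C) ?_ ?_
    intervalIntegrable_const
    (ae_of_all _ fun x hx => (hlim x (hsub hx)).comp (tendsto_add_mul_I_nhdsWithin x))
  · filter_upwards [self_mem_nhdsWithin] with y hy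
    simp_rw [im_resolventTransform _ hy]
    exact (continuous_poisson hy).aestronglyMeasurable.integral_prod_right'
  · filter_upwards [Ioo_mem_nhdsGT hδ] with y hy
    exact ae_of_all _ fun x hx => hbound x (hsub hx) y hy

lemma measure_Ioo_eq_lintegral_of_tendsto [IsFiniteMeasure μ] {g : ℝ → ℝ} {a b C δ : ℝ}
    (hδ : 0 < δ)
    (hlim : ∀ x ∈ Icc a b,
      Tendsto (fun z => (resolventTransform μ z).im) (𝓝[ℂ⁺] (x : ℂ)) (𝓝 (g x)))
    (hbound : ∀ x ∈ Icc a b, ∀ y ∈ Ioo 0 δ,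
      ‖(resolventTransform μ ((x : ℂ) + y * Complex.I)).im‖ ≤ C) :
    μ (Ioo a b) = ∫⁻ x in Ioo a b, ENNReal.ofReal (1 / Real.pi * g x) := by
  rcases le_or_gt b a with hba | hab
  · simp [Ioo_eq_empty_of_le hba]
  have hint : IntegrableOn (fun x => 1 / Real.pi * g x) (Ioo a b) :=
    ((continuousOn_of_tendsto_upperHalfPlane hlim).const_smul
      (1 / Real.pi)).integrableOn_Icc.mono_set Ioo_subset_Icc_self
  have hnonneg : 0 ≤ᵐ[volume.restrict (Ioo a b)] fun x => 1 / Real.pi * g x := by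
    refine (ae_restrict_iff' measurableSet_Ioo).2 (ae_of_all _ fun x hx => ?_)
    exact mul_nonneg (by positivity) (ge_of_tendsto (hlim x (Ioo_subset_Icc_self hx))
      (eventually_mem_nhdsWithin.mono fun z hz => im_resolventTransform_nonneg hz))
  rw [← ofReal_integral_eq_lintegral_ofReal hint hnonneg, integral_const_mul,
    ← integral_Ioc_eq_integral_Ioo, ← intervalIntegral.integral_of_le hab.le,
    intervalIntegral_eq_pi_mul_measureReal_Ioo hab hδ hlim hbound, ← mul_assoc,
    one_div_mul_cancel Real.pi_ne_zero, one_mul, ofReal_measureReal]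

lemma restrict_congr_of_nhdsWithin {X : Type*} [TopologicalSpace X] [SecondCountableTopology X]
    [MeasurableSpace X] {μ ν : Measure X} {U : Set X}
    (h : ∀ x ∈ U, ∃ s ∈ 𝓝[U] x, μ.restrict s = ν.restrict s) : μ.restrict U = ν.restrict U := by
  choose! s hs heq using h
  obtain ⟨t, htU, htc, hcover⟩ := TopologicalSpace.countable_cover_nhdsWithin hs
  exact Measure.restrict_congr_mono hcover
    ((Measure.restrict_biUnion_congr htc).2 fun x hx => heq x (htU hx))

theorem restrict_eq_withDensity_of_tendsto [IsFiniteMeasure μ] {g : ℝ → ℝ} {U : Set ℝ}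
    (hU : IsOpen U)
    (hlim : ∀ x ∈ U, Tendsto (fun z => (resolventTransform μ z).im) (𝓝[ℂ⁺] (x : ℂ)) (𝓝 (g x))) :
    μ.restrict U =
      (volume.restrict U).withDensity fun x => ENNReal.ofReal (1 / Real.pi * g x) := by
  rw [← restrict_withDensity hU.measurableSet]
  refine restrict_congr_of_nhdsWithin fun x hx => ?_
  obtain ⟨δ, hδ, hbound⟩ := exists_ball_norm_le_of_tendsto (hlim x hx)
  obtain ⟨r, hr, hball⟩ := Metric.isOpen_iff.1 hU x hx
  obtain ⟨ε, hε, hεδ, hεr⟩ : ∃ ε > 0, ε < δ ∧ ε < r :=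
    ⟨min δ r / 2, by positivity, by linarith [min_le_left δ r, lt_min hδ hr],
      by linarith [min_le_right δ r, lt_min hδ hr]⟩
  refine ⟨Ioo (x - ε) (x + ε),
    mem_nhdsWithin_of_mem_nhds (Ioo_mem_nhds (by linarith) (by linarith)), ?_⟩
  refine Real.measure_ext_Ioo_rat fun p q => ?_
  rw [Measure.restrict_apply measurableSet_Ioo, Measure.restrict_apply measurableSet_Ioo,
    Ioo_inter_Ioo, withDensity_apply _ measurableSet_Ioo]
  have hsub {s : ℝ} (hs : s ∈ Icc ((p : ℝ) ⊔ (x - ε)) ((q : ℝ) ⊓ (x + ε))) :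
      x - ε ≤ s ∧ s ≤ x + ε := ⟨le_sup_right.trans hs.1, hs.2.trans inf_le_right⟩
  refine measure_Ioo_eq_lintegral_of_tendsto hδ
    (fun s hs => hlim s (hball ?_)) (fun s hs => hbound s ?_)
  · rw [Metric.mem_ball, Real.dist_eq, abs_lt]
    constructor <;> linarith [(hsub hs).1, (hsub hs).2]
  · constructor <;> linarith [(hsub hs).1, (hsub hs).2]

end StieltjesInversion

section DensityAndSupport

variable {X : Type*} [TopologicalSpace X] [MeasurableSpace X] [OpensMeasurableSpace X]
  {μ ν : Measure X} {U : Set X} {f : X → ℝ}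

lemma measure_eq_setLIntegral_of_subset
    (hμ : μ.restrict U = (ν.restrict U).withDensity fun x => ENNReal.ofReal (f x))
    {V : Set X} (hV : IsOpen V) (hVU : V ⊆ U) : μ V = ∫⁻ x in V, ENNReal.ofReal (f x) ∂ν := by
  have h := congrArg (· V) hμ
  simpa only [Measure.restrict_apply hV.measurableSet, withDensity_apply _ hV.measurableSet,
    Measure.restrict_restrict hV.measurableSet, inter_eq_left.2 hVU] using h

lemma setOf_pos_subset_support [ν.IsOpenPosMeasure] (hU : IsOpen U) (hf : ContinuousOn f U)
    (hμ : μ.restrict U = (ν.restrict U).withDensity fun x => ENNReal.ofReal (f x)) :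
    {x ∈ U | 0 < f x} ⊆ μ.support := by
  rintro x ⟨hxU, hx⟩
  rw [Measure.support_eq_forall_isOpen]
  intro V hxV hV
  have hW : IsOpen (V ∩ (U ∩ f ⁻¹' Ioi (f x / 2))) :=
    hV.inter (hf.isOpen_inter_preimage hU isOpen_Ioi)
  calc 0 < ENNReal.ofReal (f x / 2) * ν (V ∩ (U ∩ f ⁻¹' Ioi (f x / 2))) :=
        ENNReal.mul_pos (by simpa using hx)
          (hW.measure_pos ν ⟨x, hxV, hxU, half_lt_self hx⟩).ne'
    _ = ∫⁻ _ in V ∩ (U ∩ f ⁻¹' Ioi (f x / 2)), ENNReal.ofReal (f x / 2) ∂ν :=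
        (setLIntegral_const _ _).symm
    _ ≤ ∫⁻ y in V ∩ (U ∩ f ⁻¹' Ioi (f x / 2)), ENNReal.ofReal (f y) ∂ν :=
        setLIntegral_mono' hW.measurableSet fun y hy => ENNReal.ofReal_le_ofReal (le_of_lt hy.2.2)
    _ = μ (V ∩ (U ∩ f ⁻¹' Ioi (f x / 2))) :=
        (measure_eq_setLIntegral_of_subset hμ hW fun y hy => hy.2.1).symm
    _ ≤ μ V := measure_mono inter_subset_left

lemma support_inter_subset_closure_setOf_pos (hU : IsOpen U)
    (hμ : μ.restrict U = (ν.restrict U).withDensity fun x => ENNReal.ofReal (f x)) :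
    μ.support ∩ U ⊆ closure {x ∈ U | 0 < f x} := by
  rintro x ⟨hx, hxU⟩
  by_contra hcl
  rw [Measure.support_eq_forall_isOpen] at hx
  have hV : IsOpen (U \ closure {x ∈ U | 0 < f x}) := hU.sdiff isClosed_closure
  refine (hx _ (mem_sdiff_of_mem hxU hcl) hV).ne' ?_
  rw [measure_eq_setLIntegral_of_subset hμ hV sdiff_subset]
  refine (setLIntegral_congr_fun hV.measurableSet fun y hy => ?_).trans lintegral_zero
  exact ENNReal.ofReal_of_nonpos (not_lt.1 fun hpos => hy.2 (subset_closure ⟨hy.1, hpos⟩))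

end DensityAndSupport

/-! ### The Herglotz representation on the disc -/

section Herglotz

local notation "𝕊" => Metric.sphere (0 : ℂ) 1

/-- The uniform probability measure on the unit circle, as the image of normalised Lebesgue measure
on `(0, 2π]`. -/
def circleUniform : Measure 𝕊 :=
  (ENNReal.ofReal (2 * Real.pi)⁻¹ • volume.restrict (Ioc 0 (2 * Real.pi))).map
    fun θ => ⟨circleMap 0 1 θ, circleMap_mem_sphere _ zero_le_one θ⟩

lemma continuous_circleMap_sphere :
    Continuous fun θ : ℝ => (⟨circleMap 0 1 θ, circleMap_mem_sphere _ zero_le_one θ⟩ : 𝕊) :=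
  (continuous_circleMap 0 1).subtype_mk _

instance isFiniteMeasure_circleUniform : IsFiniteMeasure circleUniform := by
  have := (volume.restrict (Ioc 0 (2 * Real.pi))).smul_finite
    (ENNReal.ofReal_ne_top (r := (2 * Real.pi)⁻¹))
  unfold circleUniform
  infer_instance

lemma integral_circleUniform {f : ℂ → ℝ} (hf : Continuous fun ζ : 𝕊 => f ζ) :
    ∫ ζ, f ζ ∂circleUniform = Real.circleAverage f 0 1 := by
  rw [circleUniform, integral_map continuous_circleMap_sphere.aemeasurable
    hf.aestronglyMeasurable, integral_smul_measure, ENNReal.toReal_ofReal (by positivity),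
    Real.circleAverage_def, intervalIntegral.integral_of_le (by positivity)]

lemma continuous_poissonKernel {w : ℂ} (hw : w ∈ Metric.ball (0 : ℂ) 1) :
    Continuous fun ζ : 𝕊 => poissonKernel 0 w ζ := by
  simp only [poissonKernel_def]
  refine Continuous.div (by fun_prop) (by fun_prop) fun ζ => pow_ne_zero 2 (norm_ne_zero_iff.2 ?_)
  rw [sub_zero, sub_zero, sub_ne_zero]
  exact fun h => Metric.sphere_disjoint_ball.ne_of_mem ζ.2 hw h

lemma poissonKernel_nonneg {w : ℂ} (hw : w ∈ Metric.ball (0 : ℂ) 1) (ζ : 𝕊) :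
    0 ≤ poissonKernel 0 w ζ := by
  rw [poissonKernel_def, sub_zero, sub_zero, norm_eq_of_mem_sphere]
  rw [mem_ball_zero_iff] at hw
  exact div_nonneg (by nlinarith [norm_nonneg w]) (by positivity)

lemma integrable_poissonKernel {w : ℂ} (hw : w ∈ Metric.ball (0 : ℂ) 1) (ν : Measure 𝕊)
    [IsFiniteMeasure ν] : Integrable (fun ζ : 𝕊 => poissonKernel 0 w ζ) ν :=
  (continuous_poissonKernel hw).integrable_of_hasCompactSupport (.of_compactSpace _)

lemma poissonKernel_mul {r : ℝ} (hr : r ≠ 0) (w ζ : ℂ) :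
    poissonKernel 0 (r * w) (r * ζ) = poissonKernel 0 w ζ := by
  simp only [poissonKernel_def, sub_zero, ← mul_sub, norm_mul, mul_pow]
  exact mul_div_mul_left _ _ (by simpa using hr)

variable {h : ℂ → ℝ}

lemma exists_measure_integral_poissonKernel_eq_comp_mul
    (hh : InnerProductSpace.HarmonicOnNhd h (Metric.ball 0 1))
    (hpos : ∀ w ∈ Metric.ball (0 : ℂ) 1, 0 ≤ h w) {r : ℝ} (hr0 : 0 < r) (hr1 : r < 1) :
    ∃ ν : Measure 𝕊, IsFiniteMeasure ν ∧ ∀ w ∈ Metric.ball (0 : ℂ) 1,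
      ∫ ζ : 𝕊, poissonKernel 0 w ζ ∂ν = h (r * w) := by
  have hsub : Metric.closedBall (0 : ℂ) r ⊆ Metric.ball 0 1 := Metric.closedBall_subset_ball hr1
  have hmem : ∀ ζ : 𝕊, (r * ζ : ℂ) ∈ Metric.ball (0 : ℂ) 1 := fun ζ => by
    simpa [abs_of_pos hr0] using hr1
  have hcont : Continuous fun ζ : 𝕊 => h (r * ζ) :=
    hh.continuousOn.comp_continuous (by fun_prop) hmem
  refine ⟨circleUniform.withDensity fun ζ => ENNReal.ofReal (h (r * ζ)),
    isFiniteMeasure_withDensity_ofReal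
      (hcont.integrable_of_hasCompactSupport (.of_compactSpace _)).2, fun w hw => ?_⟩
  have hrw : (r * w : ℂ) ∈ Metric.ball (0 : ℂ) r := by
    simpa [abs_of_pos hr0, hr0] using hw
  calc ∫ ζ : 𝕊, poissonKernel 0 w ζ ∂(circleUniform.withDensity fun ζ => ENNReal.ofReal (h (r * ζ)))
      = ∫ ζ : 𝕊, h (r * ζ) * poissonKernel 0 w ζ ∂circleUniform := by
        rw [integral_withDensity_eq_integral_toReal_smul hcont.measurable.ennreal_ofReal
          (ae_of_all _ fun _ => ENNReal.ofReal_lt_top)]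
        simp only [ENNReal.toReal_ofReal (hpos _ (hmem _)), smul_eq_mul]
    _ = Real.circleAverage (fun ζ => h (r * ζ) * poissonKernel 0 w ζ) 0 1 :=
        integral_circleUniform (f := fun ζ => h (r * ζ) * poissonKernel 0 w ζ)
          (hcont.mul (continuous_poissonKernel hw))
    _ = Real.circleAverage (poissonKernel 0 (r * w) • h) 0 r := by
        rw [Real.circleAverage_eq_circleAverage_zero_one (R := r)]
        simp only [add_zero, Pi.smul_apply', smul_eq_mul, poissonKernel_mul hr0.ne',
          mul_comm (h _)]
    _ = h (r * w) := (hh.mono hsub).circleAverage_poissonKernel_smul hrw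

/-- The measures representing `w ↦ h (r w)` have mass `h 0`, hence accumulate weakly as `r → 1`. -/
theorem exists_measure_integral_poissonKernel_eq
    (hh : InnerProductSpace.HarmonicOnNhd h (Metric.ball 0 1))
    (hpos : ∀ w ∈ Metric.ball (0 : ℂ) 1, 0 ≤ h w) :
    ∃ ν : Measure 𝕊, IsFiniteMeasure ν ∧ ∀ w ∈ Metric.ball (0 : ℂ) 1,
      ∫ ζ : 𝕊, poissonKernel 0 w ζ ∂ν = h w := by
  obtain ⟨r, -, hr, hr1⟩ := exists_seq_strictMono_tendsto' (zero_lt_one (α := ℝ))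
  choose ν hfin hν using fun n =>
    exists_measure_integral_poissonKernel_eq_comp_mul hh hpos (hr n).1 (hr n).2
  let N : ℕ → FiniteMeasure 𝕊 := fun n => ⟨ν n, hfin n⟩
  have hmass : ∀ n, (N n).mass ≤ (h 0).toNNReal := fun n => by
    have h0 := hν n 0 (by simp)
    have h1 : ∀ ζ : 𝕊, poissonKernel 0 0 ζ = 1 := fun ζ => by simp [poissonKernel_def]
    simp only [h1, mul_zero, integral_const, smul_eq_mul, mul_one] at h0
    rw [← h0]
    exact le_of_eq (by simp [N, FiniteMeasure.mass, Measure.real, ENNReal.toReal])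
  obtain ⟨N₀, -, hN₀⟩ := (isCompact_setOfPred_finiteMeasure_le_of_compactSpace 𝕊
    (h 0).toNNReal).exists_mapClusterPt (f := atTop) (u := N)
    (tendsto_principal.2 (Eventually.of_forall hmass))
  refine ⟨N₀, inferInstance, fun w hw => ?_⟩
  have hcluster := hN₀.continuousAt_comp
    (FiniteMeasure.continuous_integral_boundedContinuousFunction
      (BoundedContinuousFunction.mkOfCompact ⟨_, continuous_poissonKernel hw⟩)).continuousAt
  have hlim : Tendsto (fun n => h (r n * w)) atTop (𝓝 (h w)) := by
    have hrw : Tendsto (fun n => (r n * w : ℂ)) atTop (𝓝 w) := by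
      simpa using ((Complex.continuous_ofReal.tendsto 1).comp hr1).mul_const w
    exact (hh.continuousOn.continuousAt (Metric.isOpen_ball.mem_nhds hw)).tendsto.comp hrw
  exact eq_of_nhds_neBot (hcluster.clusterPt.mono (hlim.congr fun n => (hν n w hw).symm))

/-! ### The Cayley transform -/

/-- The Cayley transform, mapping the upper half-plane to the unit disc. -/
def cayley (z : ℂ) : ℂ := (z - Complex.I) / (z + Complex.I)

/-- The inverse Cayley transform. It maps the unit circle without `1` to the real line, and takes
the junk value `0` at `1`. -/
def cayleySymm (w : ℂ) : ℂ := Complex.I * (1 + w) / (1 - w)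

lemma add_I_ne_zero {z : ℂ} (hz : 0 ≤ z.im) : z + Complex.I ≠ 0 := by
  intro h
  have him := congrArg Complex.im h
  simp at him
  linarith

lemma one_sub_norm_cayley_sq {z : ℂ} (hz : 0 ≤ z.im) :
    1 - ‖cayley z‖ ^ 2 = 4 * z.im / ‖z + Complex.I‖ ^ 2 := by
  have hpos := norm_pos_iff.2 (add_I_ne_zero hz)
  have hsq : ‖z + Complex.I‖ ^ 2 - ‖z - Complex.I‖ ^ 2 = 4 * z.im := by
    simp only [Complex.sq_norm, Complex.normSq_apply]
    simp
    ring
  rw [cayley, norm_div, div_pow, ← hsq]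
  field_simp

lemma cayley_mem_ball {z : ℂ} (hz : 0 < z.im) : cayley z ∈ Metric.ball (0 : ℂ) 1 := by
  have hpos := norm_pos_iff.2 (add_I_ne_zero hz.le)
  have hlt : 0 < 1 - ‖cayley z‖ ^ 2 := one_sub_norm_cayley_sq hz.le ▸ by positivity
  rw [mem_ball_zero_iff]
  nlinarith [norm_nonneg (cayley z)]

lemma one_sub_cayley {z : ℂ} (hz : 0 ≤ z.im) :
    1 - cayley z = 2 * Complex.I / (z + Complex.I) := by
  have h0 := add_I_ne_zero hz
  rw [cayley]
  field_simp
  ring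

lemma cayleySymm_cayley {z : ℂ} (hz : 0 ≤ z.im) : cayleySymm (cayley z) = z := by
  have h0 := add_I_ne_zero hz
  rw [cayleySymm, one_sub_cayley hz, cayley]
  field_simp
  ring

lemma cayley_cayleySymm {w : ℂ} (hw : w ≠ 1) : cayley (cayleySymm w) = w := by
  have h1 : 1 - w ≠ 0 := sub_ne_zero.2 hw.symm
  rw [cayley, cayleySymm]
  field_simp
  ring_nf

lemma im_cayleySymm (w : ℂ) : (cayleySymm w).im = (1 - ‖w‖ ^ 2) / ‖1 - w‖ ^ 2 := by
  rw [cayleySymm, Complex.div_im, Complex.sq_norm, Complex.sq_norm, ← sub_div,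
    Complex.normSq_apply w]
  simp
  ring

lemma im_cayleySymm_pos {w : ℂ} (hw : w ∈ Metric.ball (0 : ℂ) 1) : 0 < (cayleySymm w).im := by
  rw [mem_ball_zero_iff] at hw
  have h1 : 0 < ‖1 - w‖ := norm_pos_iff.2 (sub_ne_zero.2 fun h => by simp [← h] at hw)
  rw [im_cayleySymm]
  exact div_pos (by nlinarith [norm_nonneg w]) (by positivity)

lemma differentiableOn_cayleySymm : DifferentiableOn ℂ cayleySymm (Metric.ball 0 1) := by
  refine DifferentiableOn.div (by fun_prop) (by fun_prop) fun w hw => sub_ne_zero.2 fun h => ?_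
  simp [← h] at hw

lemma cayley_re_cayleySymm {ζ : 𝕊} (hζ : (ζ : ℂ) ≠ 1) : cayley (cayleySymm ζ).re = ζ := by
  have him : (cayleySymm ζ).im = 0 := by rw [im_cayleySymm, norm_eq_of_mem_sphere]; simp
  have hre : ((cayleySymm ζ).re : ℂ) = cayleySymm ζ := Complex.ext rfl him.symm
  rw [hre, cayley_cayleySymm hζ]

lemma measurable_re_cayleySymm : Measurable fun ζ : 𝕊 => (cayleySymm ζ).re := by
  unfold cayleySymm
  fun_prop

lemma poissonKernel_cayley_one {z : ℂ} (hz : 0 < z.im) :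
    poissonKernel 0 (cayley z) 1 = z.im := by
  have hpos := norm_pos_iff.2 (add_I_ne_zero hz.le)
  rw [poissonKernel_def, sub_zero, sub_zero, norm_one, one_pow, one_sub_norm_cayley_sq hz.le,
    one_sub_cayley hz.le, norm_div, norm_mul, Complex.norm_I, Complex.norm_ofNat]
  field_simp
  norm_num

lemma poissonKernel_cayley_ofReal {z : ℂ} (hz : 0 < z.im) (x : ℝ) :
    poissonKernel 0 (cayley z) (cayley x) = (1 + x ^ 2) * (resolvent z x).im := by
  have hz0 := add_I_ne_zero hz.le
  have hx0 : (x : ℂ) + Complex.I ≠ 0 := add_I_ne_zero (by simp)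
  have hxz : (x : ℂ) - z ≠ 0 := sub_ne_zero.2 fun h => by simp [← h] at hz
  have hsub : cayley x - cayley z =
      2 * Complex.I * (x - z) / ((x + Complex.I) * (z + Complex.I)) := by
    rw [cayley, cayley]
    field_simp
    ring
  have hnorm : ‖(x : ℂ) + Complex.I‖ ^ 2 = 1 + x ^ 2 := by
    rw [Complex.sq_norm, Complex.normSq_apply]
    simp
    ring
  have hcx : ‖cayley x‖ ^ 2 = 1 := by
    have h := one_sub_norm_cayley_sq (z := (x : ℂ)) (by simp)
    rw [Complex.ofReal_im, mul_zero, zero_div] at h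
    linarith
  have := norm_pos_iff.2 hz0
  have := norm_pos_iff.2 hx0
  have := norm_pos_iff.2 hxz
  rw [poissonKernel_def, sub_zero, sub_zero, hcx, one_sub_norm_cayley_sq hz.le, hsub, ← hnorm,
    resolvent_ofReal, Complex.inv_im, ← Complex.sq_norm, norm_div, norm_mul, norm_mul, norm_mul,
    Complex.norm_I, Complex.norm_ofNat]
  simp only [Complex.sub_im, Complex.ofReal_im]
  field_simp
  norm_num

lemma poissonKernel_cayley {z : ℂ} (hz : 0 < z.im) {ζ : 𝕊} (hζ : (ζ : ℂ) ≠ 1) :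
    poissonKernel 0 (cayley z) ζ =
      (1 + (cayleySymm ζ).re ^ 2) * (resolvent z (cayleySymm ζ).re).im := by
  rw [← poissonKernel_cayley_ofReal hz, cayley_re_cayleySymm hζ]

/-! ### Nevanlinna functions of order `1 / z` -/

variable {T : ℂ → ℂ} {C : ℝ}

lemma exists_measure_integral_poissonKernel_cayley (hT : DifferentiableOn ℂ T ℂ⁺)
    (him : ∀ z ∈ ℂ⁺, 0 ≤ (T z).im) :
    ∃ ν : Measure 𝕊, IsFiniteMeasure ν ∧ ∀ z ∈ ℂ⁺,
      ∫ ζ : 𝕊, poissonKernel 0 (cayley z) ζ ∂ν = (T z).im := by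
  have hmaps : MapsTo cayleySymm (Metric.ball 0 1) ℂ⁺ := fun w hw => im_cayleySymm_pos hw
  have han : AnalyticOnNhd ℂ (T ∘ cayleySymm) (Metric.ball 0 1) :=
    (hT.comp differentiableOn_cayleySymm hmaps).analyticOnNhd Metric.isOpen_ball
  obtain ⟨ν, hν, hform⟩ := exists_measure_integral_poissonKernel_eq
    (h := fun w => (T (cayleySymm w)).im) (fun w hw => (han w hw).harmonicAt_im)
    fun w hw => him _ (hmaps hw)
  refine ⟨ν, hν, fun z hz => ?_⟩
  rw [hform _ (cayley_mem_ball hz), cayleySymm_cayley (le_of_lt hz)]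

variable {ν : Measure 𝕊} [IsFiniteMeasure ν]

/-- The Poisson kernel `P` satisfies `y P(cayley (iy), 1) = y²`. -/
lemma ae_ne_one_of_mul_integral_poissonKernel_le
    (hν : ∀ y : ℝ, 0 < y → y * ∫ ζ : 𝕊, poissonKernel 0 (cayley (y * Complex.I)) ζ ∂ν ≤ C) :
    ∀ᵐ ζ : 𝕊 ∂ν, (ζ : ℂ) ≠ 1 := by
  let one : 𝕊 := ⟨1, by simp⟩
  have hle : ∀ y : ℝ, 0 < y → ν.real {one} ≤ C / y ^ 2 := fun y hy => by
    have hy' : 0 < ((y : ℂ) * Complex.I).im := by simpa using hy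
    have hball := cayley_mem_ball hy'
    calc ν.real {one}
        = (y * ∫ ζ in ({one} : Set 𝕊), poissonKernel 0 (cayley (y * Complex.I)) ζ ∂ν) / y ^ 2 := by
          simp only [integral_singleton, one, poissonKernel_cayley_one hy', smul_eq_mul]
          simp
          field_simp
      _ ≤ C / y ^ 2 := by
          gcongr
          exact (mul_le_mul_of_nonneg_left (setIntegral_le_integral
            (integrable_poissonKernel hball ν) (ae_of_all _ (poissonKernel_nonneg hball)))
            hy.le).trans (hν y hy)
  have hlim : Tendsto (fun y : ℝ => C / y ^ 2) atTop (𝓝 0) :=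
    tendsto_const_nhds.div_atTop (tendsto_pow_atTop two_ne_zero)
  have hzero : ν.real {one} ≤ 0 :=
    ge_of_tendsto hlim ((eventually_gt_atTop 0).mono fun y hy => hle y hy)
  have hnull : ν {one} = 0 := (measureReal_eq_zero_iff).1 (hzero.antisymm measureReal_nonneg)
  filter_upwards [measure_eq_zero_iff_ae_notMem.1 hnull] with ζ hζ h
  exact hζ (Subtype.ext h)

lemma tendsto_mul_im_resolvent_mul_I (x : ℝ) :
    Tendsto (fun n : ℕ => (n + 1) * (resolvent (((n + 1 : ℝ) : ℂ) * Complex.I) x).im) atTop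
      (𝓝 1) := by
  have hlim : Tendsto (fun n : ℕ => x ^ 2 / ((n : ℝ) + 1) ^ 2) atTop (𝓝 0) :=
    tendsto_const_nhds.div_atTop ((tendsto_pow_atTop two_ne_zero).comp
      (tendsto_atTop_add_const_right _ _ tendsto_natCast_atTop_atTop))
  have hinv := (hlim.add_const 1).inv₀ (by norm_num)
  rw [zero_add, inv_one] at hinv
  refine hinv.congr fun n => ?_
  have him := im_resolvent 0 (n + 1) x
  rw [Complex.ofReal_zero, zero_add, sub_zero] at him
  rw [him]
  field_simp

lemma lintegral_one_add_re_cayleySymm_sq_le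
    (hν : ∀ y : ℝ, 0 < y → y * ∫ ζ : 𝕊, poissonKernel 0 (cayley (y * Complex.I)) ζ ∂ν ≤ C) :
    ∫⁻ ζ : 𝕊, ENNReal.ofReal (1 + (cayleySymm ζ).re ^ 2) ∂ν ≤ ENNReal.ofReal C := by
  let F : ℕ → 𝕊 → ENNReal := fun n ζ =>
    ENNReal.ofReal ((n + 1) * poissonKernel 0 (cayley ((n + 1 : ℝ) * Complex.I)) ζ)
  have him : ∀ n : ℕ, 0 < (((n + 1 : ℝ) : ℂ) * Complex.I).im := fun n => by
    rw [Complex.im_ofReal_mul, Complex.I_im, mul_one]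
    positivity
  have hball := fun n => cayley_mem_ball (him n)
  have hmeas : ∀ n, Measurable (F n) := fun n =>
    ((continuous_poissonKernel (hball n)).measurable.const_mul _).ennreal_ofReal
  have hle : ∀ n, ∫⁻ ζ, F n ζ ∂ν ≤ ENNReal.ofReal C := fun n => by
    rw [← ofReal_integral_eq_lintegral_ofReal ((integrable_poissonKernel (hball n) ν).const_mul _)
      (ae_of_all _ fun ζ => mul_nonneg (by positivity) (poissonKernel_nonneg (hball n) ζ)),
      integral_const_mul]
    exact ENNReal.ofReal_le_ofReal (hν _ (by positivity))
  have hlim : ∀ᵐ ζ : 𝕊 ∂ν, Tendsto (fun n => F n ζ) atTop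
      (𝓝 (ENNReal.ofReal (1 + (cayleySymm ζ).re ^ 2))) := by
    filter_upwards [ae_ne_one_of_mul_integral_poissonKernel_le hν] with ζ hζ
    have hone := (tendsto_mul_im_resolvent_mul_I (cayleySymm ζ).re).const_mul
      (1 + (cayleySymm ζ).re ^ 2)
    rw [mul_one] at hone
    refine ENNReal.tendsto_ofReal (hone.congr fun n => ?_)
    rw [poissonKernel_cayley (him n) hζ, mul_left_comm]
  calc ∫⁻ ζ : 𝕊, ENNReal.ofReal (1 + (cayleySymm ζ).re ^ 2) ∂ν
      = ∫⁻ ζ, liminf (fun n => F n ζ) atTop ∂ν :=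
        lintegral_congr_ae (hlim.mono fun ζ hζ => hζ.liminf_eq.symm)
    _ ≤ liminf (fun n => ∫⁻ ζ, F n ζ ∂ν) atTop := lintegral_liminf_le hmeas
    _ ≤ ENNReal.ofReal C := liminf_le_of_frequently_le' (Frequently.of_forall hle)

lemma exists_measure_im_resolventTransform_eq (hT : DifferentiableOn ℂ T ℂ⁺)
    (him : ∀ z ∈ ℂ⁺, 0 ≤ (T z).im) (hC : ∀ y : ℝ, 0 < y → y * (T (y * Complex.I)).im ≤ C) :
    ∃ μ : Measure ℝ, IsFiniteMeasure μ ∧ ∀ z ∈ ℂ⁺, (resolventTransform μ z).im = (T z).im := by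
  obtain ⟨ν, hν, hform⟩ := exists_measure_integral_poissonKernel_cayley hT him
  have hmass : ∀ y : ℝ, 0 < y →
      y * ∫ ζ : 𝕊, poissonKernel 0 (cayley (y * Complex.I)) ζ ∂ν ≤ C := fun y hy => by
    rw [hform _ (by simpa using hy)]
    exact hC y hy
  let N := ν.withDensity fun ζ => ENNReal.ofReal (1 + (cayleySymm ζ).re ^ 2)
  have hN : IsFiniteMeasure N := isFiniteMeasure_withDensity
    ((lintegral_one_add_re_cayleySymm_sq_le hmass).trans_lt ENNReal.ofReal_lt_top).ne
  have hμ : IsFiniteMeasure (N.map fun ζ : 𝕊 => (cayleySymm ζ).re) := inferInstance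
  refine ⟨N.map fun ζ : 𝕊 => (cayleySymm ζ).re, hμ, fun z hz => ?_⟩
  calc (resolventTransform (N.map fun ζ : 𝕊 => (cayleySymm ζ).re) z).im
      = ∫ x : ℝ, (resolvent z x).im ∂(N.map fun ζ : 𝕊 => (cayleySymm ζ).re) :=
        (Complex.imCLM.integral_comp_comm (integrable_resolvent_of_im_pos hz)).symm
    _ = ∫ ζ : 𝕊, (resolvent z (cayleySymm ζ).re).im ∂N :=
        integral_map measurable_re_cayleySymm.aemeasurable
          (Complex.measurable_im.comp measurable_resolvent).aestronglyMeasurable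
    _ = ∫ ζ : 𝕊, poissonKernel 0 (cayley z) ζ ∂ν := by
        rw [integral_withDensity_eq_integral_toReal_smul
          ((measurable_re_cayleySymm.pow_const 2).const_add 1).ennreal_ofReal
          (ae_of_all _ fun _ => ENNReal.ofReal_lt_top)]
        refine integral_congr_ae ?_
        filter_upwards [ae_ne_one_of_mul_integral_poissonKernel_le hmass] with ζ hζ
        rw [poissonKernel_cayley hz hζ, ENNReal.toReal_ofReal (by positivity), smul_eq_mul]
    _ = (T z).im := hform z hz

lemma isConnected_upperHalfPlane : IsConnected ℂ⁺ :=
  ⟨⟨Complex.I, by simp⟩, (convex_halfSpace_im_gt 0).isPreconnected⟩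

lemma differentiableOn_resolventTransform (μ : Measure ℝ) [IsFiniteMeasure μ] :
    DifferentiableOn ℂ (resolventTransform μ) ℂ⁺ := fun z hz =>
  (hasDerivAt_resolventTransform z
    (notMem_ofReal_image_of_im_pos hz _)).differentiableAt.differentiableWithinAt

lemma mul_norm_resolventTransform_le (μ : Measure ℝ) [IsFiniteMeasure μ] {z : ℂ} (hz : 0 < z.im) :
    z.im * ‖resolventTransform μ z‖ ≤ μ.real univ := by
  have hle : ‖resolventTransform μ z‖ ≤ 1 / z.im * μ.real univ :=
    norm_integral_le_of_norm_le_const (ae_of_all _ fun l => norm_resolvent_le hz l)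
  rwa [one_div, ← div_eq_inv_mul, le_div_iff₀' hz] at hle

/-- A finite measure can be recovered up to a real constant from the imaginary part; the decay along
the imaginary axis makes that constant `0`. -/
theorem exists_measure_resolventTransform_eq (hT : DifferentiableOn ℂ T ℂ⁺)
    (him : ∀ z ∈ ℂ⁺, 0 ≤ (T z).im) (hC : ∀ y : ℝ, 0 < y → y * ‖T (y * Complex.I)‖ ≤ C) :
    ∃ μ : Measure ℝ, IsFiniteMeasure μ ∧ ∀ z ∈ ℂ⁺, resolventTransform μ z = T z := by
  obtain ⟨μ, hμ, hIm⟩ := exists_measure_im_resolventTransform_eq hT him fun y hy =>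
    (mul_le_mul_of_nonneg_left ((le_abs_self _).trans (Complex.abs_im_le_norm _)) hy.le).trans
      (hC y hy)
  have han : AnalyticOnNhd ℂ (fun z => resolventTransform μ z - T z) ℂ⁺ :=
    ((differentiableOn_resolventTransform μ).sub hT).analyticOnNhd
      UpperHalfPlane.isOpen_upperHalfPlaneSet
  obtain ⟨w, hw⟩ := han.eq_const_of_im_eq_const (c₀ := 0)
    (fun z hz => by rw [Complex.sub_im, hIm z hz, sub_self])
    UpperHalfPlane.isOpen_upperHalfPlaneSet isConnected_upperHalfPlane
  have hlim : Tendsto (fun y : ℝ => (μ.real univ + C) / y) atTop (𝓝 0) :=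
    tendsto_const_nhds.div_atTop tendsto_id
  have hw0 : ‖w‖ ≤ 0 := by
    refine ge_of_tendsto hlim ?_
    filter_upwards [eventually_gt_atTop 0] with y hy
    have hy' : 0 < ((y : ℂ) * Complex.I).im := by simpa using hy
    have hμy := mul_norm_resolventTransform_le μ hy'
    rw [Complex.im_ofReal_mul, Complex.I_im, mul_one] at hμy
    rw [le_div_iff₀' hy, ← hw _ hy']
    calc y * ‖resolventTransform μ (y * Complex.I) - T (y * Complex.I)‖
        ≤ y * (‖resolventTransform μ (y * Complex.I)‖ + ‖T (y * Complex.I)‖) := by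
          gcongr
          exact norm_sub_le _ _
      _ ≤ μ.real univ + C := by linarith [hC y hy]
  refine ⟨μ, hμ, fun z hz => ?_⟩
  rw [← sub_eq_zero, hw z hz, norm_le_zero_iff.1 hw0]

end Herglotz

section CanonicalCurve

open scoped BigOperators

variable {ι : Type*} [Fintype ι] {lam : ι → ℝ} {c : ℝ} {z t u v : ℂ}

/-- `G(u)`, the normalized trace of `R (1 + u R)⁻¹` in terms of the eigenvalues of `R`. -/
def resolventMean (lam : ι → ℝ) (u : ℂ) : ℂ :=
  𝔼 i, (lam i : ℂ) / (1 + u * lam i)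

/-- The negated divided difference of `G = resolventMean lam`, with value `-G'(u)` on the
diagonal. -/
def resolventSlope (lam : ι → ℝ) (u v : ℂ) : ℂ :=
  𝔼 i, (lam i : ℂ) ^ 2 / ((1 + u * lam i) * (1 + v * lam i))

/-- `B(u)`, the normalized squared Frobenius norm of `R (1 + u R)⁻¹` in terms of the eigenvalues
of `R`. -/
def resolventSqMean (lam : ι → ℝ) (u : ℂ) : ℝ :=
  𝔼 i, lam i ^ 2 / ‖1 + u * lam i‖ ^ 2

lemma ne_zero_of_im_pos (hu : 0 < u.im) : u ≠ 0 :=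
  fun h => by simp [h] at hu

lemma one_add_mul_ofReal_ne_zero (hu : 0 < u.im) (l : ℝ) : 1 + u * l ≠ 0 := by
  intro h
  have him : u.im * l = 0 := by simpa using congrArg Complex.im h
  obtain rfl := (mul_eq_zero.1 him).resolve_left hu.ne'
  simp at h

lemma resolventSqMean_nonneg (lam : ι → ℝ) (u : ℂ) : 0 ≤ resolventSqMean lam u :=
  Finset.expect_nonneg fun _ _ => by positivity

lemma resolventSqMean_pos (hlam : lam ≠ 0) (hu : ∀ i, 1 + u * lam i ≠ 0) :
    0 < resolventSqMean lam u := by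
  obtain ⟨i, hi⟩ := Function.ne_iff.1 hlam
  have hi : lam i ≠ 0 := hi
  have := norm_pos_iff.2 (hu i)
  exact Finset.expect_pos' (fun _ _ => by positivity) ⟨i, Finset.mem_univ i, by positivity⟩

lemma expect_div_norm_sq_pos (hlam : 0 < lam) (hu : ∀ i, 1 + u * lam i ≠ 0) :
    0 < 𝔼 i, lam i / ‖1 + u * lam i‖ ^ 2 := by
  obtain ⟨hle, i, hi⟩ := Pi.lt_def.1 hlam
  exact Finset.expect_pos' (fun j _ => div_nonneg (hle j) (by positivity))
    ⟨i, Finset.mem_univ i, div_pos hi (pow_pos (norm_pos_iff.2 (hu i)) 2)⟩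

lemma resolventMean_sub (hu : ∀ i, 1 + u * lam i ≠ 0) (hv : ∀ i, 1 + v * lam i ≠ 0) :
    resolventMean lam u - resolventMean lam v = (v - u) * resolventSlope lam u v := by
  rw [resolventMean, resolventMean, resolventSlope, ← Finset.expect_sub_distrib, Finset.mul_expect]
  refine Finset.expect_congr rfl fun i _ => ?_
  rw [div_sub_div _ _ (hu i) (hv i)]
  ring

lemma norm_resolventSlope_sq_le (lam : ι → ℝ) (u v : ℂ) :
    ‖resolventSlope lam u v‖ ^ 2 ≤ resolventSqMean lam u * resolventSqMean lam v := by
  have htriangle : ‖resolventSlope lam u v‖ ≤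
      𝔼 i, (|lam i| / ‖1 + u * lam i‖) * (|lam i| / ‖1 + v * lam i‖) := by
    refine (RCLike.norm_expect_le (K := ℂ)).trans_eq (Finset.expect_congr rfl fun i _ => ?_)
    simp only [norm_div, norm_mul, norm_pow, Complex.norm_real, Real.norm_eq_abs]
    ring
  have hCauchySchwarz := Finset.sum_mul_sq_le_sq_mul_sq Finset.univ
    (fun i => |lam i| / ‖1 + u * lam i‖) (fun i => |lam i| / ‖1 + v * lam i‖)
  simp only [div_pow, sq_abs] at hCauchySchwarz
  refine (pow_le_pow_left₀ (norm_nonneg _) htriangle 2).trans ?_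
  simp only [resolventSqMean, Fintype.expect_eq_sum_div_card, div_pow]
  rw [div_mul_div_comm, ← sq]
  gcongr

lemma norm_resolventSlope_self_le (lam : ι → ℝ) (u : ℂ) :
    ‖resolventSlope lam u u‖ ≤ resolventSqMean lam u :=
  le_of_sq_le_sq ((norm_resolventSlope_sq_le lam u u).trans_eq (sq _).symm)
    (resolventSqMean_nonneg lam u)

lemma im_resolventMean (lam : ι → ℝ) (u : ℂ) :
    (resolventMean lam u).im = -(resolventSqMean lam u * u.im) := by
  rw [resolventMean, resolventSqMean, Complex.im_expect, Finset.expect_mul,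
    ← Finset.expect_neg_distrib]
  refine Finset.expect_congr rfl fun i _ => ?_
  rw [Complex.div_im, ← Complex.sq_norm]
  simp
  ring

lemma norm_sq_mul_im_of_mul_eq (h : z * t = -resolventMean lam u) :
    ‖z‖ ^ 2 * t.im =
      (𝔼 i, lam i / ‖1 + u * lam i‖ ^ 2) * z.im + resolventSqMean lam u * (z * u).im := by
  have hconj : ((‖z‖ ^ 2 : ℝ) : ℂ) * t = 𝔼 i, -(starRingEnd ℂ z * (lam i / (1 + u * lam i))) := by
    rw [Finset.expect_neg_distrib, ← Finset.mul_expect, ← resolventMean, ← mul_neg, ← h,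
      ← mul_assoc, mul_comm (starRingEnd ℂ z), Complex.mul_conj, Complex.sq_norm]
  rw [← Complex.im_ofReal_mul, hconj, Complex.im_expect, resolventSqMean, Finset.expect_mul,
    Finset.expect_mul, ← Finset.expect_add_distrib]
  refine Finset.expect_congr rfl fun i _ => ?_
  rw [Complex.neg_im, Complex.mul_im, Complex.div_im, Complex.div_re, ← Complex.sq_norm]
  simp
  ring

/-! ### The curve of solutions -/

/-- `(z, t, u)` lies on the curve defined by `t = -G(u) / z` and `u = c t / (1 - z c² t²)`, with
`t` and `u` in the upper half-plane. The second equation is written for `u⁻¹`, which makes imaginary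
parts easy to compute. -/
structure IsCurvePoint (lam : ι → ℝ) (c : ℝ) (z t u : ℂ) : Prop where
  t_im_pos : 0 < t.im
  u_im_pos : 0 < u.im
  mul_eq : z * t = -resolventMean lam u
  inv_eq : u⁻¹ = (c * t)⁻¹ - c * (z * t)

lemma im_inv_sub_mul (c : ℝ) (t w : ℂ) :
    ((c * t)⁻¹ - c * w : ℂ).im = -(t.im / (c * ‖t‖ ^ 2) + c * w.im) := by
  rw [Complex.sub_im, Complex.im_ofReal_mul, mul_inv, ← Complex.ofReal_inv,
    Complex.im_ofReal_mul, Complex.inv_im, ← Complex.sq_norm]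
  ring

lemma im_eq_of_inv_eq {w : ℂ} (h : u⁻¹ = (c * t)⁻¹ - c * w) :
    u.im = ‖u‖ ^ 2 * (t.im / (c * ‖t‖ ^ 2) + c * w.im) := by
  by_cases hu : u = 0
  · simp [hu]
  · have him := im_inv_sub_mul c t w
    rw [← h, Complex.inv_im, ← Complex.sq_norm, neg_div, neg_inj] at him
    rw [← him]
    field_simp

lemma im_pos_of_inv_eq {w : ℂ} (hc : 0 < c) (ht : 0 < t.im) (hw : 0 ≤ w.im)
    (h : u⁻¹ = (c * t)⁻¹ - c * w) : 0 < u.im := by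
  have ht0 := norm_pos_iff.2 (ne_zero_of_im_pos ht)
  have hpos : 0 < t.im / (c * ‖t‖ ^ 2) + c * w.im := by positivity
  have hu : u ≠ 0 := by
    rintro rfl
    have him := im_inv_sub_mul c t w
    rw [← h, inv_zero, Complex.zero_im] at him
    linarith
  rw [im_eq_of_inv_eq h]
  exact mul_pos (pow_pos (norm_pos_iff.2 hu) 2) hpos

lemma inv_mul_eq_of_inv_eq (hz : z ≠ 0) (h : u⁻¹ = (c * t)⁻¹ - c * (z * t)) :
    (z * u)⁻¹ = (c * (z * t))⁻¹ - c * t := by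
  rw [mul_inv, h, mul_sub, mul_left_comm (c : ℂ) z, mul_inv z]
  field_simp

lemma div_le_of_mul_eq_of_mul_le {a b p q r : ℝ} (ha : 0 < a) (hb : 0 < b) (hp : 0 < p)
    (hr : 0 < r) (hq : b * q = p * a) (hle : p * b ≤ r ^ 2 * a * q) : p / r ≤ q := by
  have hq0 : 0 < q := pos_of_mul_pos_right (hq ▸ mul_pos hp ha) hb.le
  rw [div_le_iff₀ hr]
  refine le_of_sq_le_sq (le_of_mul_le_mul_right ?_ hb) (by positivity)
  calc p ^ 2 * b = p * (p * b) := by ring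
    _ ≤ p * (r ^ 2 * a * q) := by gcongr
    _ = (q * r) ^ 2 * b := by linear_combination -(r ^ 2 * q) * hq

lemma div_lt_of_mul_eq_of_mul_lt {a b p q r : ℝ} (ha : 0 < a) (hb : 0 < b) (hp : 0 < p)
    (hr : 0 < r) (hq : b * q = p * a) (hlt : p * b < r ^ 2 * a * q) : p / r < q := by
  refine (div_le_of_mul_eq_of_mul_le ha hb hp hr hq hlt.le).lt_of_ne ?_
  rintro rfl
  have hlt' : p * b < r * a * p := by
    convert! hlt using 1
    field_simp
  have hq' : p * b = r * a * p := by
    rw [mul_div_assoc', div_eq_iff hr.ne'] at hq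
    linarith
  exact hlt'.ne hq'

namespace IsCurvePoint

lemma t_ne_zero (h : IsCurvePoint lam c z t u) : t ≠ 0 :=
  ne_zero_of_im_pos h.t_im_pos

lemma u_ne_zero (h : IsCurvePoint lam c z t u) : u ≠ 0 :=
  ne_zero_of_im_pos h.u_im_pos

lemma one_add_mul_ne_zero (h : IsCurvePoint lam c z t u) (i : ι) : 1 + u * lam i ≠ 0 :=
  one_add_mul_ofReal_ne_zero h.u_im_pos (lam i)

lemma im_mul_t (h : IsCurvePoint lam c z t u) : (z * t).im = resolventSqMean lam u * u.im := by
  rw [h.mul_eq, Complex.neg_im, im_resolventMean, neg_neg]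

lemma im_mul_t_pos (h : IsCurvePoint lam c z t u) (hlam : lam ≠ 0) : 0 < (z * t).im := by
  rw [h.im_mul_t]
  exact mul_pos (resolventSqMean_pos hlam h.one_add_mul_ne_zero) h.u_im_pos

lemma z_ne_zero (h : IsCurvePoint lam c z t u) (hlam : lam ≠ 0) : z ≠ 0 := by
  rintro rfl
  simpa using h.im_mul_t_pos hlam

lemma im_mul_u (h : IsCurvePoint lam c z t u) (hlam : lam ≠ 0) :
    (z * u).im = ‖z * u‖ ^ 2 * ((z * t).im / (c * ‖z * t‖ ^ 2) + c * t.im) :=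
  im_eq_of_inv_eq (inv_mul_eq_of_inv_eq (h.z_ne_zero hlam) h.inv_eq)

lemma im_mul_u_nonneg (h : IsCurvePoint lam c z t u) (hlam : lam ≠ 0) (hc : 0 ≤ c) :
    0 ≤ (z * u).im := by
  rw [h.im_mul_u hlam]
  have := h.t_im_pos
  have := h.im_mul_t_pos hlam
  positivity

-- The imaginary parts of the two equations form a linear system for `(Im (z t), Im t)`; that its
-- solution is positive forces the bounds below.

lemma im_mul_t_mul_eq (h : IsCurvePoint lam c z t u) :
    (z * t).im * (1 - resolventSqMean lam u * ‖u‖ ^ 2 * c) =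
      resolventSqMean lam u * ‖u‖ ^ 2 / (c * ‖t‖ ^ 2) * t.im := by
  have him := h.im_mul_t
  rw [im_eq_of_inv_eq h.inv_eq] at him
  linear_combination him

lemma norm_sq_mul_t_im_mul_eq (h : IsCurvePoint lam c z t u) (hlam : lam ≠ 0) :
    ‖z‖ ^ 2 * t.im * (1 - resolventSqMean lam u * ‖u‖ ^ 2 * c) =
      (𝔼 i, lam i / ‖1 + u * lam i‖ ^ 2) * z.im +
        resolventSqMean lam u * ‖u‖ ^ 2 / (c * ‖t‖ ^ 2) * (z * t).im := by
  have him := norm_sq_mul_im_of_mul_eq h.mul_eq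
  rw [h.im_mul_u hlam, norm_mul, norm_mul] at him
  have hz := norm_pos_iff.2 (h.z_ne_zero hlam)
  have hcancel : ‖z‖ ^ 2 * ((z * t).im / (c * (‖z‖ * ‖t‖) ^ 2)) = (z * t).im / (c * ‖t‖ ^ 2) := by
    rw [mul_pow]
    field_simp
  linear_combination him + resolventSqMean lam u * ‖u‖ ^ 2 * hcancel

theorem contraction_le (h : IsCurvePoint lam c z t u) (hlam : 0 < lam) (hc : 0 < c)
    (hz : 0 ≤ z.im) :
    resolventSqMean lam u * ‖u‖ ^ 2 * (c + 1 / (c * ‖z‖ * ‖t‖ ^ 2)) ≤ 1 := by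
  have hB := resolventSqMean_pos hlam.ne' h.one_add_mul_ne_zero
  have hu := norm_pos_iff.2 h.u_ne_zero
  have ht := norm_pos_iff.2 h.t_ne_zero
  have hD := (expect_div_norm_sq_pos hlam h.one_add_mul_ne_zero).le
  have := div_le_of_mul_eq_of_mul_le h.t_im_pos (h.im_mul_t_pos hlam.ne') (by positivity)
    (norm_pos_iff.2 (h.z_ne_zero hlam.ne')) h.im_mul_t_mul_eq
    (by rw [h.norm_sq_mul_t_im_mul_eq hlam.ne']; linarith [mul_nonneg hD hz])
  rw [div_div] at this
  calc _ = resolventSqMean lam u * ‖u‖ ^ 2 / (c * ‖t‖ ^ 2 * ‖z‖) +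
        resolventSqMean lam u * ‖u‖ ^ 2 * c := by ring
    _ ≤ 1 := by linarith

theorem contraction_lt (h : IsCurvePoint lam c z t u) (hlam : 0 < lam) (hc : 0 < c)
    (hz : 0 < z.im) :
    resolventSqMean lam u * ‖u‖ ^ 2 * (c + 1 / (c * ‖z‖ * ‖t‖ ^ 2)) < 1 := by
  have hB := resolventSqMean_pos hlam.ne' h.one_add_mul_ne_zero
  have hu := norm_pos_iff.2 h.u_ne_zero
  have ht := norm_pos_iff.2 h.t_ne_zero
  have hD := expect_div_norm_sq_pos hlam h.one_add_mul_ne_zero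
  have := div_lt_of_mul_eq_of_mul_lt h.t_im_pos (h.im_mul_t_pos hlam.ne') (by positivity)
    (norm_pos_iff.2 (h.z_ne_zero hlam.ne')) h.im_mul_t_mul_eq
    (by rw [h.norm_sq_mul_t_im_mul_eq hlam.ne']; linarith [mul_pos hD hz])
  rw [div_div] at this
  calc _ = resolventSqMean lam u * ‖u‖ ^ 2 / (c * ‖t‖ ^ 2 * ‖z‖) +
        resolventSqMean lam u * ‖u‖ ^ 2 * c := by ring
    _ < 1 := by linarith

end IsCurvePoint

/-! ### The canonical equation in terms of the eigenvalues -/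

lemma smul_one_add_smul_eq_conjStarAlgAut {n 𝕜 : Type*} [Fintype n] [DecidableEq n] [RCLike 𝕜]
    {R : Matrix n n 𝕜} (hR : R.IsHermitian) (a b : 𝕜) :
    a • (1 : Matrix n n 𝕜) + b • R = Unitary.conjStarAlgAut 𝕜 (Matrix n n 𝕜) hR.eigenvectorUnitary
      (Matrix.diagonal fun i => a + b * (hR.eigenvalues i : 𝕜)) := by
  have hdiag : (Matrix.diagonal fun i => a + b * (hR.eigenvalues i : 𝕜)) =
      a • (1 : Matrix n n 𝕜) + b • Matrix.diagonal (RCLike.ofReal ∘ hR.eigenvalues) := by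
    rw [← Matrix.diagonal_one, ← Matrix.diagonal_smul, ← Matrix.diagonal_smul,
      Matrix.diagonal_add]
    simp
  rw [hdiag, map_add, map_smul, map_smul, map_one, ← hR.spectral_theorem]

lemma trace_mul_inv_smul_one_add_smul {n 𝕜 : Type*} [Fintype n] [DecidableEq n] [RCLike 𝕜]
    {R : Matrix n n 𝕜} (hR : R.IsHermitian) {a b : 𝕜}
    (hab : ∀ i, a + b * (hR.eigenvalues i : 𝕜) ≠ 0) :
    (R * (a • (1 : Matrix n n 𝕜) + b • R)⁻¹).trace =
      ∑ i, (hR.eigenvalues i : 𝕜) / (a + b * hR.eigenvalues i) := by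
  have hinv : (a • (1 : Matrix n n 𝕜) + b • R)⁻¹ =
      Unitary.conjStarAlgAut 𝕜 (Matrix n n 𝕜) hR.eigenvectorUnitary
        (Matrix.diagonal fun i => (a + b * (hR.eigenvalues i : 𝕜))⁻¹) := by
    apply Matrix.inv_eq_left_inv
    rw [smul_one_add_smul_eq_conjStarAlgAut hR, ← map_mul, Matrix.diagonal_mul_diagonal]
    simp only [inv_mul_cancel₀ (hab _), Matrix.diagonal_one, map_one]
  rw [hinv]
  nth_rewrite 1 [hR.spectral_theorem]
  rw [← map_mul, Matrix.diagonal_mul_diagonal, Unitary.conjStarAlgAut_apply,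
    Matrix.trace_mul_cycle, Unitary.coe_star_mul_self, one_mul, Matrix.trace_diagonal]
  simp only [Function.comp_apply, div_eq_mul_inv]

lemma inv_eq_iff_eq_div (hc : c ≠ 0) (ht : t ≠ 0) :
    u⁻¹ = (c * t)⁻¹ - c * (z * t) ↔ u = c * t / (1 - z * (c : ℂ) ^ 2 * t ^ 2) := by
  have hc0 : (c : ℂ) ≠ 0 := Complex.ofReal_ne_zero.2 hc
  have hinv : (c * t : ℂ)⁻¹ - c * (z * t) = (c * t / (1 - z * (c : ℂ) ^ 2 * t ^ 2))⁻¹ := by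
    rw [inv_div]
    field_simp
  rw [hinv, inv_inj]

lemma eq_mul_trace_iff {M : ℕ} {R : Matrix (Fin M) (Fin M) ℂ} (hR : R.IsHermitian) (hz : z ≠ 0)
    (hu : ∀ i, 1 + u * (hR.eigenvalues i : ℂ) ≠ 0) :
    t = (1 / (M : ℂ)) * (R * (-(z • (1 : Matrix (Fin M) (Fin M) ℂ)) - (z * u) • R)⁻¹).trace ↔
      z * t = -resolventMean hR.eigenvalues u := by
  have hden : ∀ l : ℝ, -z + -(z * u) * (l : ℂ) = -z * (1 + u * l) := fun l => by ring
  have htrace : (R * (-(z • (1 : Matrix (Fin M) (Fin M) ℂ)) - (z * u) • R)⁻¹).trace =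
      -(∑ i, (hR.eigenvalues i : ℂ) / (1 + u * hR.eigenvalues i)) / z := by
    have := trace_mul_inv_smul_one_add_smul hR (a := -z) (b := -(z * u)) fun i => by
      exact (hden _).trans_ne (mul_ne_zero (neg_ne_zero.2 hz) (hu i))
    rw [neg_smul, neg_smul, ← sub_eq_add_neg] at this
    rw [this, neg_div, Finset.sum_div, ← Finset.sum_neg_distrib]
    refine Finset.sum_congr rfl fun i _ => ?_
    rw [← neg_div_neg_eq, div_div, RCLike.ofReal_eq_complex_ofReal, hden]
    ring
  rw [htrace, resolventMean, Fintype.expect_eq_sum_div_card, Fintype.card_fin, mul_div_assoc',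
    eq_div_iff hz, mul_comm t, one_div_mul_eq_div, neg_div]

lemma isCanonicalSolution_iff {M : ℕ} {R : Matrix (Fin M) (Fin M) ℂ} (hR : R.IsHermitian)
    (hlam : hR.eigenvalues ≠ 0) (hc : 0 < c) :
    IsCanonicalSolution R c z t ↔ ∃ u, IsCurvePoint hR.eigenvalues c z t u := by
  have hassoc : z * c * t / (1 - z * (c : ℂ) ^ 2 * t ^ 2) =
      z * (c * t / (1 - z * (c : ℂ) ^ 2 * t ^ 2)) := by ring
  rw [IsCanonicalSolution, hassoc]
  constructor
  · rintro ⟨ht, hzt, heq⟩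
    have hz : z ≠ 0 := by
      rintro rfl
      simp at hzt
    have hinv := (inv_eq_iff_eq_div (z := z) hc.ne' (ne_zero_of_im_pos ht)).2 rfl
    have hu := im_pos_of_inv_eq hc ht hzt.le hinv
    exact ⟨_, ht, hu, (eq_mul_trace_iff hR hz fun i => one_add_mul_ofReal_ne_zero hu _).1 heq, hinv⟩
  · rintro ⟨u, h⟩
    rw [← (inv_eq_iff_eq_div hc.ne' h.t_ne_zero).1 h.inv_eq]
    exact ⟨h.t_im_pos, h.im_mul_t_pos hlam,
      (eq_mul_trace_iff hR (h.z_ne_zero hlam) h.one_add_mul_ne_zero).2 h.mul_eq⟩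

/-! ### Uniqueness and local analyticity -/

lemma norm_add_one_div_sq_le (hc : 0 < c) (z t₁ t₂ : ℂ) :
    ‖(c + 1 / (c * z * t₁ * t₂) : ℂ)‖ ^ 2 ≤
      (c + 1 / (c * ‖z‖ * ‖t₁‖ ^ 2)) * (c + 1 / (c * ‖z‖ * ‖t₂‖ ^ 2)) := by
  have htriangle : ‖(c + 1 / (c * z * t₁ * t₂) : ℂ)‖ ≤ c + 1 / (c * ‖z‖ * ‖t₁‖ * ‖t₂‖) := by
    refine (norm_add_le _ _).trans_eq ?_
    simp only [norm_div, norm_mul, norm_one, Complex.norm_real, Real.norm_eq_abs, abs_of_pos hc]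
  have hmean : 0 ≤ 1 / ‖z‖ * (‖t₁‖⁻¹ - ‖t₂‖⁻¹) ^ 2 := by positivity
  calc _ ≤ (c + 1 / (c * ‖z‖ * ‖t₁‖ * ‖t₂‖)) ^ 2 := by gcongr
    _ = (c + 1 / (c * ‖z‖ * ‖t₁‖ ^ 2)) * (c + 1 / (c * ‖z‖ * ‖t₂‖ ^ 2)) -
        1 / ‖z‖ * (‖t₁‖⁻¹ - ‖t₂‖⁻¹) ^ 2 := by
      field_simp
      ring
    _ ≤ _ := sub_le_self _ hmean

lemma norm_add_one_div_lt {x : ℝ} (hx : 0 < x) (hc : 0 < c) (ht : 0 < t.im) :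
    ‖(c + 1 / (c * x * t * t) : ℂ)‖ < c + 1 / (c * x * ‖t‖ ^ 2) := by
  have hsum : c + 1 / (c * x * ‖t‖ ^ 2) = ‖(c : ℂ)‖ + ‖(1 / (c * x * t * t) : ℂ)‖ := by
    simp only [norm_div, norm_mul, norm_one, Complex.norm_real, Real.norm_eq_abs, abs_of_pos hc,
      abs_of_pos hx, sq, mul_assoc]
  rw [hsum]
  refine norm_add_lt_of_not_sameRay fun hray => ?_
  have ht0 := ne_zero_of_im_pos ht
  have hc0 : (c : ℂ) ≠ 0 := Complex.ofReal_ne_zero.2 hc.ne'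
  have hx0 : (x : ℂ) ≠ 0 := Complex.ofReal_ne_zero.2 hx.ne'
  obtain ⟨r, hr, hr'⟩ := hray.exists_pos_left hc0 (by positivity)
  have hr0 : (r : ℂ) ≠ 0 := Complex.ofReal_ne_zero.2 hr.ne'
  have hsq : t ^ 2 = ((√(r * c ^ 2 * x)⁻¹ : ℝ) : ℂ) ^ 2 := by
    rw [← Complex.ofReal_pow, Real.sq_sqrt (by positivity)]
    rw [Complex.real_smul] at hr'
    push_cast
    field_simp at hr' ⊢
    linear_combination hr'
  rcases sq_eq_sq_iff_eq_or_eq_neg.1 hsq with h | h <;> simp [h] at ht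

namespace IsCurvePoint

variable {t₁ u₁ t₂ u₂ : ℂ}

lemma t_sub_eq (h₁ : IsCurvePoint lam c z t₁ u₁) (h₂ : IsCurvePoint lam c z t₂ u₂)
    (hlam : lam ≠ 0) (hc : c ≠ 0) :
    t₁ - t₂ = (t₁ - t₂) *
      (u₁ * u₂ * resolventSlope lam u₁ u₂ * (c + 1 / (c * z * t₁ * t₂))) := by
  have hc0 : (c : ℂ) ≠ 0 := Complex.ofReal_ne_zero.2 hc
  have hz := h₁.z_ne_zero hlam
  have ht₁ := h₁.t_ne_zero
  have ht₂ := h₂.t_ne_zero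
  have hu₁ := h₁.u_ne_zero
  have hu₂ := h₂.u_ne_zero
  have hu : u₁ - u₂ = u₁ * u₂ * (u₂⁻¹ - u₁⁻¹) := by field_simp
  have ht : z * (t₁ - t₂) = (u₁ - u₂) * resolventSlope lam u₁ u₂ := by
    linear_combination h₁.mul_eq - h₂.mul_eq -
      resolventMean_sub h₁.one_add_mul_ne_zero h₂.one_add_mul_ne_zero
  rw [hu, h₁.inv_eq, h₂.inv_eq] at ht
  rw [← mul_right_inj' hz, ht]
  field_simp
  ring

theorem t_unique (h₁ : IsCurvePoint lam c z t₁ u₁) (h₂ : IsCurvePoint lam c z t₂ u₂)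
    (hlam : 0 < lam) (hc : 0 < c) (hz : 0 < z.im) : t₁ = t₂ := by
  by_contra hne
  have hone : u₁ * u₂ * resolventSlope lam u₁ u₂ * (c + 1 / (c * z * t₁ * t₂)) = 1 :=
    (mul_left_cancel₀ (sub_ne_zero.2 hne)
      ((mul_one _).trans (h₁.t_sub_eq h₂ hlam.ne' hc.ne'))).symm
  have hB₁ := resolventSqMean_nonneg lam u₁
  have hB₂ := resolventSqMean_nonneg lam u₂
  refine lt_irrefl (1 : ℝ) ?_
  calc (1 : ℝ) = ‖u₁ * u₂ * resolventSlope lam u₁ u₂ * (c + 1 / (c * z * t₁ * t₂))‖ ^ 2 := by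
        rw [hone, norm_one, one_pow]
    _ = ‖u₁‖ ^ 2 * ‖u₂‖ ^ 2 * ‖resolventSlope lam u₁ u₂‖ ^ 2 *
        ‖(c + 1 / (c * z * t₁ * t₂) : ℂ)‖ ^ 2 := by
      rw [norm_mul, norm_mul, norm_mul]
      ring
    _ ≤ ‖u₁‖ ^ 2 * ‖u₂‖ ^ 2 * (resolventSqMean lam u₁ * resolventSqMean lam u₂) *
        ((c + 1 / (c * ‖z‖ * ‖t₁‖ ^ 2)) * (c + 1 / (c * ‖z‖ * ‖t₂‖ ^ 2))) := by
      gcongr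
      · exact norm_resolventSlope_sq_le lam u₁ u₂
      · exact norm_add_one_div_sq_le hc z t₁ t₂
    _ = (resolventSqMean lam u₁ * ‖u₁‖ ^ 2 * (c + 1 / (c * ‖z‖ * ‖t₁‖ ^ 2))) *
        (resolventSqMean lam u₂ * ‖u₂‖ ^ 2 * (c + 1 / (c * ‖z‖ * ‖t₂‖ ^ 2))) := by ring
    _ < 1 := mul_lt_one_of_nonneg_of_lt_one_left (by positivity)
      (h₁.contraction_lt hlam hc hz) (h₂.contraction_le hlam hc hz.le)

theorem u_unique (h₁ : IsCurvePoint lam c z t₁ u₁) (h₂ : IsCurvePoint lam c z t₂ u₂)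
    (hlam : 0 < lam) (hc : 0 < c) (hz : 0 < z.im) : u₁ = u₂ := by
  rw [← inv_inj, h₁.inv_eq, h₂.inv_eq, h₁.t_unique h₂ hlam hc hz]

theorem norm_sq_mul_resolventSlope_lt (h : IsCurvePoint lam c z t u) (hlam : 0 < lam) (hc : 0 < c)
    (hz : 0 ≤ z.im) :
    ‖u ^ 2 * resolventSlope lam u u * (c + 1 / (c * z * t * t))‖ < 1 := by
  have hB := resolventSqMean_pos hlam.ne' h.one_add_mul_ne_zero
  have hslope := norm_resolventSlope_self_le lam u
  have hu := norm_pos_iff.2 h.u_ne_zero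
  rw [norm_mul, norm_mul, norm_pow, mul_comm (‖u‖ ^ 2)]
  rcases hz.lt_or_eq with hz | hz
  · have hfactor := norm_add_one_div_sq_le hc z t t
    rw [← sq] at hfactor
    have hfactor' := le_of_sq_le_sq hfactor (by positivity)
    calc _ ≤ resolventSqMean lam u * ‖u‖ ^ 2 * (c + 1 / (c * ‖z‖ * ‖t‖ ^ 2)) := by gcongr
      _ < 1 := h.contraction_lt hlam hc hz
  · obtain ⟨x, rfl⟩ : ∃ x : ℝ, (x : ℂ) = z := ⟨z.re, Complex.ext rfl hz⟩
    have hx : 0 < x := by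
      have := h.im_mul_t_pos hlam.ne'
      rw [Complex.im_ofReal_mul] at this
      exact pos_of_mul_pos_left this h.t_im_pos.le
    have hle := h.contraction_le hlam hc hz.le
    rw [Complex.norm_real, Real.norm_eq_abs, abs_of_pos hx] at hle
    calc _ ≤ resolventSqMean lam u * ‖u‖ ^ 2 * ‖(c + 1 / (c * x * t * t) : ℂ)‖ := by gcongr
      _ < resolventSqMean lam u * ‖u‖ ^ 2 * (c + 1 / (c * x * ‖t‖ ^ 2)) := by
        gcongr
        exact norm_add_one_div_lt hx hc h.t_im_pos
      _ ≤ 1 := hle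

end IsCurvePoint

lemma hasDerivAt_resolventMean (hu : ∀ i, 1 + u * lam i ≠ 0) :
    HasDerivAt (resolventMean lam) (-resolventSlope lam u u) u := by
  have hterm (i : ι) : HasDerivAt (fun v : ℂ => (lam i : ℂ) / (1 + v * lam i))
      (-((lam i : ℂ) ^ 2 / ((1 + u * lam i) * (1 + u * lam i)))) u := by
    have hden : HasDerivAt (fun v : ℂ => 1 + v * lam i) (lam i : ℂ) u := by
      simpa using ((hasDerivAt_id u).mul_const (lam i : ℂ)).const_add 1
    convert! (hasDerivAt_const u (lam i : ℂ)).fun_div hden (hu i) using 1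
    ring
  have hsum := (HasDerivAt.fun_sum fun i (_ : i ∈ Finset.univ) => hterm i).div_const
    (Fintype.card ι : ℂ)
  rw [← Fintype.expect_eq_sum_div_card, Finset.expect_neg_distrib] at hsum
  simp only [← Fintype.expect_eq_sum_div_card] at hsum
  exact hsum

/-- The set where `curveZ` is analytic: the complement of the zero set of `u det (1 + u R)`. -/
def regularSet (lam : ι → ℝ) : Set ℂ :=
  {u | u ≠ 0 ∧ ∀ i, 1 + u * lam i ≠ 0}

/-- The parametrization `Z(u) = -c G(u) (1 - c u G(u)) / u` of the first coordinate of the curve of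
solutions by its third coordinate. -/
def curveZ (lam : ι → ℝ) (c : ℝ) (u : ℂ) : ℂ :=
  -(c * resolventMean lam u * (1 - c * u * resolventMean lam u)) / u

omit [Fintype ι] in
lemma isOpen_regularSet [Finite ι] (lam : ι → ℝ) : IsOpen (regularSet lam) :=
  isOpen_ne.and <| by
    simp only [ofPred_forall]
    exact isOpen_iInter_of_finite fun i => isOpen_ne_fun (by fun_prop) continuous_const

omit [Fintype ι] in
lemma mem_regularSet_of_im_pos (hu : 0 < u.im) : u ∈ regularSet lam :=
  ⟨ne_zero_of_im_pos hu, fun i => one_add_mul_ofReal_ne_zero hu (lam i)⟩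

lemma isCurvePoint_iff (hlam : lam ≠ 0) (hc : c ≠ 0) :
    IsCurvePoint lam c z t u ↔
      0 < t.im ∧ 0 < u.im ∧ z = curveZ lam c u ∧ t = -resolventMean lam u / z := by
  have hc0 : (c : ℂ) ≠ 0 := Complex.ofReal_ne_zero.2 hc
  refine ⟨fun h => ?_, fun ⟨ht, hu, hz, htz⟩ => ?_⟩
  · have hz := h.z_ne_zero hlam
    have ht := h.t_ne_zero
    have hu := h.u_ne_zero
    have hG : resolventMean lam u = -(z * t) := by rw [h.mul_eq, neg_neg]
    have hinv := h.inv_eq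
    refine ⟨h.t_im_pos, h.u_im_pos, ?_, ?_⟩
    · rw [curveZ, hG]
      field_simp at hinv ⊢
      linear_combination -hinv
    · rw [hG]
      field_simp
  · have ht0 := ne_zero_of_im_pos ht
    have hu0 := ne_zero_of_im_pos hu
    have hz0 : z ≠ 0 := by
      rintro rfl
      simp [htz] at ht0
    have hG : resolventMean lam u = -(z * t) := by
      rw [htz]
      field_simp
    refine ⟨ht, hu, by rw [hG, neg_neg], ?_⟩
    rw [curveZ, hG] at hz
    field_simp at hz ⊢
    linear_combination -hz

lemma hasDerivAt_curveZ (hu : u ∈ regularSet lam) :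
    HasDerivAt (curveZ lam c)
      ((-curveZ lam c u + c * resolventSlope lam u u + c ^ 2 * resolventMean lam u ^ 2 -
        2 * c ^ 2 * u * resolventMean lam u * resolventSlope lam u u) / u) u := by
  have hu0 : u ≠ 0 := hu.1
  have hG := hasDerivAt_resolventMean hu.2
  have hlinear : HasDerivAt (fun v : ℂ => (c : ℂ) * v) c u := by
    simpa using (hasDerivAt_id u).const_mul (c : ℂ)
  convert! ((hG.const_mul (c : ℂ)).mul ((hlinear.mul hG).const_sub 1)).neg.div (hasDerivAt_id u)
    hu0 using 1
  simp only [curveZ, id, Pi.mul_apply, Pi.neg_apply]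
  field_simp
  ring

lemma analyticOnNhd_curveZ (lam : ι → ℝ) (c : ℝ) :
    AnalyticOnNhd ℂ (curveZ lam c) (regularSet lam) :=
  DifferentiableOn.analyticOnNhd
    (fun _ hu => (hasDerivAt_curveZ hu).differentiableAt.differentiableWithinAt)
    (isOpen_regularSet lam)

namespace IsCurvePoint

lemma of_im_nonneg (hc : 0 < c) (hu : 0 ≤ u.im) (ht : 0 < t.im)
    (hmul : z * t = -resolventMean lam u) (hinv : u⁻¹ = (c * t)⁻¹ - c * (z * t)) :
    IsCurvePoint lam c z t u := by
  refine ⟨ht, im_pos_of_inv_eq hc ht ?_ hinv, hmul, hinv⟩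
  rw [hmul, Complex.neg_im, im_resolventMean, neg_neg]
  exact mul_nonneg (resolventSqMean_nonneg lam u) hu

lemma curveZ_eq (h : IsCurvePoint lam c z t u) (hlam : lam ≠ 0) (hc : c ≠ 0) :
    curveZ lam c u = z :=
  ((isCurvePoint_iff hlam hc).1 h).2.2.1.symm

lemma t_eq (h : IsCurvePoint lam c z t u) (hlam : lam ≠ 0) : t = -resolventMean lam u / z := by
  rw [← h.mul_eq, mul_div_cancel_left₀ _ (h.z_ne_zero hlam)]

lemma hasDerivAt_curveZ (h : IsCurvePoint lam c z t u) (hlam : lam ≠ 0) (hc : c ≠ 0) :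
    HasDerivAt (curveZ lam c)
      (-(c * z * t / u ^ 2) * (1 - u ^ 2 * resolventSlope lam u u * (c + 1 / (c * z * t * t))))
      u := by
  convert! _root_.hasDerivAt_curveZ (lam := lam) (c := c) (mem_regularSet_of_im_pos h.u_im_pos)
    using 1
  have hc0 : (c : ℂ) ≠ 0 := Complex.ofReal_ne_zero.2 hc
  have hz := h.z_ne_zero hlam
  have ht := h.t_ne_zero
  have hu := h.u_ne_zero
  have hinv := h.inv_eq
  have hG : resolventMean lam u = -(z * t) := by rw [h.mul_eq, neg_neg]
  rw [h.curveZ_eq hlam hc, hG]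
  field_simp at hinv ⊢
  grind

theorem deriv_curveZ_ne_zero (h : IsCurvePoint lam c z t u) (hlam : 0 < lam) (hc : 0 < c)
    (hz : 0 ≤ z.im) : deriv (curveZ lam c) u ≠ 0 := by
  have hz0 := h.z_ne_zero hlam.ne'
  have ht := h.t_ne_zero
  have hu := h.u_ne_zero
  have : (c : ℂ) ≠ 0 := Complex.ofReal_ne_zero.2 hc.ne'
  rw [(h.hasDerivAt_curveZ hlam.ne' hc.ne').deriv]
  refine mul_ne_zero (neg_ne_zero.2 (by positivity)) (sub_ne_zero.2 fun hone => ?_)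
  have hlt := h.norm_sq_mul_resolventSlope_lt hlam hc hz
  rw [← hone, norm_one] at hlt
  exact lt_irrefl _ hlt

theorem exists_analyticAt (h : IsCurvePoint lam c z t u) (hlam : 0 < lam) (hc : 0 < c)
    (hz : 0 ≤ z.im) :
    ∃ T U : ℂ → ℂ, AnalyticAt ℂ T z ∧ AnalyticAt ℂ U z ∧ T z = t ∧ U z = u ∧
      ∀ᶠ w in 𝓝 z, IsCurvePoint lam c w (T w) (U w) := by
  have hureg : u ∈ regularSet lam := mem_regularSet_of_im_pos h.u_im_pos
  have hZ := analyticOnNhd_curveZ lam c u hureg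
  have hderiv := h.deriv_curveZ_ne_zero hlam hc hz
  have hU := hZ.analyticAt_localInverse hderiv
  have hright := hZ.hasStrictDerivAt.eventually_right_inverse hderiv
  set U := hZ.hasStrictDerivAt.localInverse _ _ _ hderiv
  have hUz : U (curveZ lam c u) = u := HasStrictFDerivAt.localInverse_apply_image ..
  rw [h.curveZ_eq hlam.ne' hc.ne'] at hU hUz hright
  have hG : AnalyticAt ℂ (resolventMean lam) (U z) := hUz ▸
    DifferentiableOn.analyticAt (fun v hv =>
      (hasDerivAt_resolventMean hv.2).differentiableAt.differentiableWithinAt)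
      ((isOpen_regularSet lam).mem_nhds hureg)
  have hT : AnalyticAt ℂ (fun w => -resolventMean lam (U w) / w) z :=
    (hG.fun_comp hU).fun_neg.fun_div analyticAt_id (h.z_ne_zero hlam.ne')
  have hTz : -resolventMean lam (U z) / z = t := by rw [hUz, ← h.t_eq hlam.ne']
  refine ⟨_, U, hT, hU, hTz, hUz, ?_⟩
  filter_upwards [hright,
    (Complex.continuous_im.continuousAt.comp hU.continuousAt).eventually
      (lt_mem_nhds (by simpa [hUz] using h.u_im_pos)),
    (Complex.continuous_im.continuousAt.comp hT.continuousAt).eventually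
      (lt_mem_nhds (by simpa [hTz] using h.t_im_pos))] with w hw hUw hTw
  exact (isCurvePoint_iff hlam.ne' hc.ne').2 ⟨hTw, hUw, hw.symm, rfl⟩

end IsCurvePoint

/-! ### A priori bounds -/

lemma norm_resolventMean_le (lam : ι → ℝ) {η : ℝ} (hη : 0 < η)
    (hu : ∀ i, η ≤ ‖1 + u * lam i‖) : ‖resolventMean lam u‖ ≤ 𝔼 i, |lam i| / η := by
  refine (RCLike.norm_expect_le (K := ℂ)).trans (Finset.expect_le_expect fun i _ => ?_)
  rw [norm_div, Complex.norm_real, Real.norm_eq_abs]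
  have := hu i
  gcongr

lemma norm_mul_resolventMean_le (lam : ι → ℝ) {η : ℝ} (hη : 0 < η)
    (hu : ∀ i, η ≤ ‖1 + u * lam i‖) : ‖u * resolventMean lam u‖ ≤ 1 + 1 / η := by
  rcases isEmpty_or_nonempty ι with hι | hι
  · simp only [resolventMean, Finset.univ_eq_empty, Finset.expect_empty, mul_zero, norm_zero]
    positivity
  rw [resolventMean, Finset.mul_expect]
  refine (RCLike.norm_expect_le (K := ℂ)).trans
    (Finset.expect_le Finset.univ_nonempty fun i _ => ?_)
  have hne : 1 + u * lam i ≠ 0 := norm_pos_iff.1 (hη.trans_le (hu i))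
  have hterm : u * (lam i / (1 + u * lam i)) = 1 - 1 / (1 + u * lam i) := by
    field_simp
    ring
  rw [hterm]
  refine (norm_sub_le _ _).trans ?_
  rw [norm_one, norm_div, norm_one]
  have := hu i
  gcongr

lemma sq_div_le_card_mul_resolventSqMean (lam : ι → ℝ) (u : ℂ) (i : ι) :
    lam i ^ 2 / ‖1 + u * lam i‖ ^ 2 ≤ Fintype.card ι * resolventSqMean lam u := by
  rw [resolventSqMean, Fintype.card_mul_expect]
  exact Finset.single_le_sum (f := fun j => lam j ^ 2 / ‖1 + u * lam j‖ ^ 2)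
    (fun j _ => by positivity) (Finset.mem_univ i)

lemma resolventMean_zero (lam : ι → ℝ) : resolventMean lam 0 = ((𝔼 i, lam i : ℝ) : ℂ) := by
  simp [resolventMean, Complex.ofReal_expect]

lemma expect_pos_of_pos (hlam : 0 < lam) : 0 < 𝔼 i, lam i := by
  simpa using expect_div_norm_sq_pos (u := 0) hlam (by simp)

lemma tendsto_curveZ_mul (lam : ι → ℝ) (c : ℝ) :
    Tendsto (fun u => curveZ lam c u * u) (𝓝[≠] 0) (𝓝 (-(c * 𝔼 i, lam i : ℝ) : ℂ)) := by
  have hG : ContinuousAt (resolventMean lam) 0 :=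
    (hasDerivAt_resolventMean (by simp)).continuousAt
  have hnum : ContinuousAt
      (fun u => -(c * resolventMean lam u * (1 - c * u * resolventMean lam u))) 0 := by fun_prop
  have hlim := hnum.tendsto.mono_left (nhdsWithin_le_nhds (s := {0}ᶜ))
  simp only [resolventMean_zero, mul_zero, zero_mul, sub_zero, mul_one] at hlim
  refine (hlim.congr' ?_).trans_eq (by push_cast; rfl)
  filter_upwards [self_mem_nhdsWithin] with u hu
  rw [curveZ, div_mul_cancel₀ _ hu]

lemma tendsto_curveZ_cobounded (hlam : 0 < lam) (hc : c ≠ 0) :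
    Tendsto (curveZ lam c) (𝓝[≠] 0) (Bornology.cobounded ℂ) := by
  have hlim := (tendsto_curveZ_mul lam c).norm
  have hpos : 0 < ‖(-(c * 𝔼 i, lam i : ℝ) : ℂ)‖ := by
    have := expect_pos_of_pos hlam
    rw [norm_neg, Complex.norm_real]
    exact norm_pos_iff.2 (mul_ne_zero hc this.ne')
  rw [← tendsto_norm_atTop_iff_cobounded]
  refine (hlim.pos_mul_atTop hpos
    (tendsto_norm_atTop_iff_cobounded.2 tendsto_inv₀_nhdsNE_zero)).congr' ?_
  filter_upwards [self_mem_nhdsWithin] with u hu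
  rw [← norm_mul, mul_inv_cancel_right₀ hu]

namespace IsCurvePoint

lemma exists_le_norm_one_add_mul (hlam : 0 < lam) (hc : 0 < c) :
    ∃ η : ℝ, 0 < η ∧ ∀ z t u, 0 ≤ z.im → IsCurvePoint lam c z t u →
      ∀ i, η ≤ ‖1 + u * lam i‖ := by
  refine ⟨1 / (1 + √(Fintype.card ι / c)), by positivity, fun z t u hz h i => ?_⟩
  have hcard : (0 : ℝ) < Fintype.card ι := Nat.cast_pos.2 (Fintype.card_pos_iff.2 ⟨i⟩)
  have hden := norm_pos_iff.2 (h.one_add_mul_ne_zero i)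
  have hB : resolventSqMean lam u * ‖u‖ ^ 2 * c ≤ 1 := by
    refine le_trans ?_ (h.contraction_le hlam hc hz)
    have := resolventSqMean_nonneg lam u
    gcongr
    exact le_add_of_nonneg_right (by positivity)
  have hterm := sq_div_le_card_mul_resolventSqMean lam u i
  have hsq : ‖u * lam i‖ ^ 2 ≤ Fintype.card ι / c * ‖1 + u * lam i‖ ^ 2 := by
    rw [div_mul_eq_mul_div, le_div_iff₀ hc, norm_mul, Complex.norm_real, Real.norm_eq_abs,
      mul_pow, sq_abs]
    rw [div_le_iff₀ (by positivity)] at hterm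
    calc ‖u‖ ^ 2 * lam i ^ 2 * c = lam i ^ 2 * (‖u‖ ^ 2 * c) := by ring
      _ ≤ Fintype.card ι * resolventSqMean lam u * ‖1 + u * lam i‖ ^ 2 * (‖u‖ ^ 2 * c) := by
        gcongr
      _ = Fintype.card ι * ‖1 + u * lam i‖ ^ 2 * (resolventSqMean lam u * ‖u‖ ^ 2 * c) := by ring
      _ ≤ Fintype.card ι * ‖1 + u * lam i‖ ^ 2 := mul_le_of_le_one_right (by positivity) hB
  have hle : ‖u * lam i‖ ≤ √(Fintype.card ι / c) * ‖1 + u * lam i‖ := by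
    refine le_of_sq_le_sq ?_ (by positivity)
    rwa [mul_pow, Real.sq_sqrt (by positivity)]
  have htriangle := norm_sub_le_norm_add (1 : ℂ) (u * lam i)
  rw [norm_one] at htriangle
  rw [div_le_iff₀ (by positivity)]
  linarith

lemma exists_norm_mul_t_le (hlam : 0 < lam) (hc : 0 < c) :
    ∃ C : ℝ, ∀ z t u, 0 ≤ z.im → IsCurvePoint lam c z t u → ‖z * t‖ ≤ C := by
  obtain ⟨η, hη, hle⟩ := exists_le_norm_one_add_mul hlam hc
  refine ⟨𝔼 i, |lam i| / η, fun z t u hz h => ?_⟩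
  rw [h.mul_eq, norm_neg]
  exact norm_resolventMean_le lam hη (hle z t u hz h)

lemma exists_norm_mul_norm_sq_le (hlam : 0 < lam) (hc : 0 < c) :
    ∃ C : ℝ, ∀ z t u, 0 ≤ z.im → IsCurvePoint lam c z t u → ‖z‖ * ‖u‖ ^ 2 ≤ C := by
  obtain ⟨η, hη, hle⟩ := exists_le_norm_one_add_mul hlam hc
  refine ⟨c * (1 + 1 / η) * (1 + c * (1 + 1 / η)), fun z t u hz h => ?_⟩
  have hu := h.u_ne_zero
  have hnorm : ‖c * (u * resolventMean lam u)‖ ≤ c * (1 + 1 / η) := by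
    rw [norm_mul, Complex.norm_real, Real.norm_eq_abs, abs_of_pos hc]
    gcongr
    exact norm_mul_resolventMean_le lam hη (hle z t u hz h)
  have heq : z * u ^ 2 =
      -(c * (u * resolventMean lam u) * (1 - c * (u * resolventMean lam u))) := by
    rw [← h.curveZ_eq hlam.ne' hc.ne', curveZ]
    field_simp
  rw [← norm_pow, ← norm_mul, heq, norm_neg, norm_mul]
  gcongr
  refine (norm_sub_le _ _).trans ?_
  rw [norm_one]
  gcongr

theorem exists_isCompact_forall_mem (hlam : 0 < lam) (hc : 0 < c) {z₀ : ℂ} (hz₀ : z₀ ≠ 0) :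
    ∃ K : Set ℂ, IsCompact K ∧ K ⊆ regularSet lam ∧
      ∀ᶠ z in 𝓝 z₀, ∀ t u, 0 ≤ z.im → IsCurvePoint lam c z t u → u ∈ K := by
  obtain ⟨η, hη, hle⟩ := exists_le_norm_one_add_mul hlam hc
  obtain ⟨C, hC⟩ := exists_norm_mul_norm_sq_le hlam hc
  have hfar : ∀ᶠ u in 𝓝[≠] (0 : ℂ), 2 * ‖z₀‖ < ‖curveZ lam c u‖ :=
    (tendsto_norm_atTop_iff_cobounded.2
      (tendsto_curveZ_cobounded hlam hc.ne')).eventually_gt_atTop _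
  obtain ⟨δ, hδ, hball⟩ := Metric.mem_nhdsWithin_iff.1 hfar
  have hr := norm_pos_iff.2 hz₀
  refine ⟨Metric.closedBall 0 (√(2 * C / ‖z₀‖)) ∩ ({u | δ ≤ ‖u‖} ∩ ⋂ i, {u | η ≤ ‖1 + u * lam i‖}),
    (isCompact_closedBall _ _).inter_right (IsClosed.inter
      (isClosed_le continuous_const continuous_norm)
      (isClosed_iInter fun i => isClosed_le continuous_const (by fun_prop))), ?_, ?_⟩
  · rintro u ⟨-, hu, hreg⟩
    exact ⟨norm_pos_iff.1 (hδ.trans_le hu),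
      fun i => norm_pos_iff.1 (hη.trans_le (mem_iInter.1 hreg i))⟩
  have hlower : ∀ᶠ z in 𝓝 z₀, ‖z₀‖ / 2 < ‖z‖ :=
    continuous_norm.continuousAt.eventually_const_lt (half_lt_self hr)
  have hupper : ∀ᶠ z in 𝓝 z₀, ‖z‖ < 2 * ‖z₀‖ :=
    continuous_norm.continuousAt.eventually_lt_const (lt_mul_left hr one_lt_two)
  filter_upwards [hlower, hupper] with z hzl hzu t u hz h
  refine ⟨?_, ?_, mem_iInter.2 (hle z t u hz h)⟩
  · rw [mem_closedBall_zero_iff]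
    refine Real.le_sqrt_of_sq_le ((le_div_iff₀ hr).2 ?_)
    have := hC z t u hz h
    nlinarith [sq_nonneg ‖u‖]
  · refine mem_ofPred.2 (not_lt.1 fun hlt => ?_)
    have hbig := hball ⟨mem_ball_zero_iff.2 hlt, h.u_ne_zero⟩
    rw [mem_ofPred_eq, h.curveZ_eq hlam.ne' hc.ne'] at hbig
    linarith

end IsCurvePoint

/-! ### Existence -/

namespace IsCurvePoint

lemma exists_of_tendsto {α : Type*} {l : Filter α} [l.NeBot] {z t u : α → ℂ} {z₀ u₀ : ℂ}
    (hlam : 0 < lam) (hc : 0 < c) (hz₀ : 0 < z₀.im) (hu₀ : u₀ ∈ regularSet lam)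
    (h : ∀ᶠ a in l, IsCurvePoint lam c (z a) (t a) (u a)) (hz : Tendsto z l (𝓝 z₀))
    (hu : Tendsto u l (𝓝 u₀)) : ∃ t₀, IsCurvePoint lam c z₀ t₀ u₀ := by
  have hz₀0 := ne_zero_of_im_pos hz₀
  have him : 0 ≤ u₀.im := ge_of_tendsto ((Complex.continuous_im.tendsto u₀).comp hu)
    (h.mono fun a ha => ha.u_im_pos.le)
  have him_mul : 0 ≤ (z₀ * u₀).im :=
    ge_of_tendsto ((Complex.continuous_im.tendsto _).comp (hz.mul hu))
      (h.mono fun a ha => ha.im_mul_u_nonneg hlam.ne' hc.le)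
  have hG := (hasDerivAt_resolventMean hu₀.2).continuousAt.tendsto.comp hu
  have ht : Tendsto t l (𝓝 (-resolventMean lam u₀ / z₀)) :=
    (hG.neg.div hz hz₀0).congr' (h.mono fun a ha => (ha.t_eq hlam.ne').symm)
  have hmul : z₀ * (-resolventMean lam u₀ / z₀) = -resolventMean lam u₀ :=
    mul_div_cancel₀ _ hz₀0
  have ht_im : 0 < (-resolventMean lam u₀ / z₀).im := by
    have := norm_pos_iff.2 hz₀0
    refine pos_of_mul_pos_right ?_ (sq_nonneg ‖z₀‖)
    rw [norm_sq_mul_im_of_mul_eq hmul]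
    exact add_pos_of_pos_of_nonneg (mul_pos (expect_div_norm_sq_pos hlam hu₀.2) hz₀)
      (mul_nonneg (resolventSqMean_nonneg lam u₀) him_mul)
  have hc_mul : (c * (-resolventMean lam u₀ / z₀) : ℂ) ≠ 0 :=
    mul_ne_zero (Complex.ofReal_ne_zero.2 hc.ne') (ne_zero_of_im_pos ht_im)
  refine ⟨_, of_im_nonneg hc him ht_im hmul (tendsto_nhds_unique (hu.inv₀ hu₀.1) ?_)⟩
  exact (((ht.const_mul (c : ℂ)).inv₀ hc_mul).sub ((hz.mul ht).const_mul (c : ℂ))).congr'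
    (h.mono fun a ha => ha.inv_eq.symm)

end IsCurvePoint

lemma tendsto_ofReal_mul_I_nhdsNE :
    Tendsto (fun e : ℝ => (e : ℂ) * Complex.I) (𝓝[>] 0) (𝓝[≠] 0) := by
  refine tendsto_nhdsWithin_iff.2 ⟨?_, ?_⟩
  · exact (Continuous.tendsto' (by fun_prop) _ _ (by simp)).mono_left nhdsWithin_le_nhds
  · filter_upwards [self_mem_nhdsWithin] with e he
    simpa using he.ne'

lemma tendsto_neg_resolventMean_div_curveZ_mul (hlam : 0 < lam) (hc : c ≠ 0) :
    Tendsto (fun u => -resolventMean lam u / (curveZ lam c u * u)) (𝓝[≠] 0)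
      (𝓝 ((1 / c : ℝ) : ℂ)) := by
  have hg := (expect_pos_of_pos hlam).ne'
  have hG : Tendsto (resolventMean lam) (𝓝[≠] 0) (𝓝 (𝔼 i, lam i : ℝ)) := by
    rw [← resolventMean_zero]
    exact (hasDerivAt_resolventMean (by simp)).continuousAt.tendsto.mono_left nhdsWithin_le_nhds
  have hne : (-(c * 𝔼 i, lam i : ℝ) : ℂ) ≠ 0 :=
    neg_ne_zero.2 (Complex.ofReal_ne_zero.2 (mul_ne_zero hc hg))
  refine (hG.neg.div (tendsto_curveZ_mul lam c) hne).trans_eq ?_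
  rw [neg_div_neg_eq, ← Complex.ofReal_div]
  congr 2
  field_simp

-- As `u = i ε` tends to `0`, `Z(u) ~ -c G(0) / u` goes to `+i ∞` and `t ~ u / c`.
lemma exists_isCurvePoint_im_pos (hlam : 0 < lam) (hc : 0 < c) :
    ∃ z t u, 0 < z.im ∧ IsCurvePoint lam c z t u := by
  have hZ_lim : (-(c * 𝔼 i, lam i : ℝ) : ℂ).re < 0 := by
    rw [Complex.neg_re, Complex.ofReal_re]
    exact neg_lt_zero.2 (mul_pos hc (expect_pos_of_pos hlam))
  have hZ_re := ((Complex.continuous_re.tendsto _).comp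
    ((tendsto_curveZ_mul lam c).comp tendsto_ofReal_mul_I_nhdsNE)).eventually_lt_const hZ_lim
  have hquot_re := ((Complex.continuous_re.tendsto _).comp
    ((tendsto_neg_resolventMean_div_curveZ_mul hlam hc.ne').comp
      tendsto_ofReal_mul_I_nhdsNE)).eventually_const_lt
    (show 0 < ((1 / c : ℝ) : ℂ).re from one_div_pos.2 hc)
  obtain ⟨e, hZe, hquote, he⟩ := (hZ_re.and (hquot_re.and self_mem_nhdsWithin)).exists
  have he : 0 < e := he
  simp only [Function.comp_apply] at hZe hquote
  set u : ℂ := e * Complex.I with hu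
  have hu_im : 0 < u.im := by simpa [hu] using he
  have ht : -resolventMean lam u / curveZ lam c u =
      e * (Complex.I * (-resolventMean lam u / (curveZ lam c u * u))) := by
    have : u ≠ 0 := ne_zero_of_im_pos hu_im
    rw [← mul_assoc, ← hu]
    field_simp
  refine ⟨curveZ lam c u, _, u, ?_,
    (isCurvePoint_iff hlam.ne' hc.ne').2 ⟨?_, hu_im, rfl, rfl⟩⟩
  · have hre : (curveZ lam c u * u).re = -(e * (curveZ lam c u).im) := by
      simp [hu]
      ring
    rw [hre, neg_lt_zero] at hZe
    exact pos_of_mul_pos_right hZe he.le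
  · rw [ht, Complex.im_ofReal_mul, Complex.I_mul_im]
    exact mul_pos he hquote

theorem exists_isCurvePoint (hlam : 0 < lam) (hc : 0 < c) (hz : 0 < z.im) :
    ∃ t u, IsCurvePoint lam c z t u := by
  set S : Set ℂ := {z | 0 < z.im ∧ ∃ t u, IsCurvePoint lam c z t u}
  have hopen : IsOpen S := by
    refine isOpen_iff_mem_nhds.2 fun z₀ ⟨hz₀, t₀, u₀, h₀⟩ => ?_
    obtain ⟨T, U, -, -, -, -, hTU⟩ := h₀.exists_analyticAt hlam hc hz₀.le
    filter_upwards [hTU, UpperHalfPlane.isOpen_upperHalfPlaneSet.mem_nhds hz₀] with w hw hw_im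
    exact ⟨hw_im, _, _, hw⟩
  have hne : (ℂ⁺ ∩ S).Nonempty := by
    obtain ⟨z₁, t₁, u₁, hz₁, h₁⟩ := exists_isCurvePoint_im_pos hlam hc
    exact ⟨z₁, hz₁, hz₁, t₁, u₁, h₁⟩
  have hclosed : closure S ∩ ℂ⁺ ⊆ S := by
    rintro z₀ ⟨hcl, hz₀⟩
    obtain ⟨x, hxS, hx⟩ := mem_closure_iff_seq_limit.1 hcl
    choose hx_im t u hcurve using hxS
    obtain ⟨K, hK, hreg, hev⟩ := IsCurvePoint.exists_isCompact_forall_mem hlam hc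
      (ne_zero_of_im_pos hz₀)
    have hu : ∀ᶠ n in atTop, u n ∈ K :=
      (hx.eventually hev).mono fun n hn => hn _ _ (hx_im n).le (hcurve n)
    obtain ⟨u₀, hu₀, φ, hφ, hlim⟩ := hK.tendsto_subseq' hu.frequently
    obtain ⟨t₀, h₀⟩ := IsCurvePoint.exists_of_tendsto hlam hc hz₀ (hreg hu₀)
      (Eventually.of_forall fun n => hcurve (φ n)) (hx.comp hφ.tendsto_atTop) hlim
    exact ⟨hz₀, t₀, u₀, h₀⟩
  exact ((convex_halfSpace_im_gt 0).isPreconnected.subset_of_closure_inter_subset hopen hne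
    hclosed hz).2

/-! ### Boundary values of the solution -/

lemma tendsto_of_mapClusterPt_of_eventually_not_mapClusterPt {α X : Type*} [TopologicalSpace X]
    [RegularSpace X] {l : Filter α} {f : α → X} {K : Set X} {p : X} (hK : IsCompact K)
    (hfK : ∀ᶠ a in l, f a ∈ K)
    (hconn : ∀ s ∈ l, ∃ s' ∈ l, s' ⊆ s ∧ IsPreconnected (f '' s'))
    (hp : MapClusterPt p l f) (hiso : ∀ᶠ q in 𝓝[≠] p, ¬ MapClusterPt q l f) :
    Tendsto f l (𝓝 p) := by
  refine tendsto_def.2 fun W hW => ?_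
  obtain ⟨C, hC, hC_closed, hCW⟩ := exists_mem_nhds_isClosed_subset
    (inter_mem hW (eventually_nhdsWithin_iff.1 hiso))
  have hfrontier : ∀ᶠ a in l, f a ∉ frontier (interior C) := by
    by_contra hfreq
    have hfreq' : ∃ᶠ a in l, f a ∈ frontier (interior C) ∩ K :=
      (not_eventually.1 hfreq).and_eventually hfK |>.mono fun a ha => ⟨not_not.1 ha.1, ha.2⟩
    obtain ⟨q, ⟨hq, -⟩, hq_cluster⟩ :=
      (hK.inter_left isClosed_frontier).exists_mapClusterPt_of_frequently hfreq'
    have hqC : q ∈ C := closure_minimal interior_subset hC_closed hq.1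
    refine (hCW hqC).2 ?_ hq_cluster
    rintro rfl
    exact hq.2 (by rwa [interior_interior, mem_interior_iff_mem_nhds])
  obtain ⟨s, hs, hs_sub, hs_conn⟩ := hconn _ hfrontier
  obtain ⟨a, ha, has⟩ := ((hp.frequently (interior_mem_nhds.2 hC)).and_eventually hs).exists
  have hsC : f '' s ⊆ interior C :=
    hs_conn.subset_of_closure_inter_subset isOpen_interior ⟨f a, mem_image_of_mem f has, ha⟩ <| by
      rintro _ ⟨hcl, b, hb, rfl⟩
      by_contra hbC
      exact hs_sub hb ⟨hcl, by rwa [interior_interior]⟩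
  exact mem_of_superset hs fun b hb => (hCW (interior_subset (hsC (mem_image_of_mem f hb)))).1

omit [Fintype ι] in
lemma isPreconnected_regularSet [Finite ι] (lam : ι → ℝ) : IsPreconnected (regularSet lam) := by
  have hsub : (regularSet lam)ᶜ ⊆ insert 0 (range fun i => -((lam i : ℂ)⁻¹)) := by
    intro u hu
    by_contra hu'
    simp only [mem_insert_iff, mem_range, not_or, not_exists] at hu'
    refine hu ⟨hu'.1, fun i h => hu'.2 i ?_⟩
    have hl : (lam i : ℂ) ≠ 0 := fun h0 => by simp [h0] at h
    field_simp
    linear_combination -h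
  have hcountable : (regularSet lam)ᶜ.Countable := ((countable_range _).insert 0).mono hsub
  simpa using (hcountable.isConnected_compl_of_one_lt_rank (by simp)).isPreconnected

omit [Fintype ι] in
lemma regularSet_mem_nhdsNE_zero [Finite ι] (lam : ι → ℝ) : regularSet lam ∈ 𝓝[≠] (0 : ℂ) := by
  have hne : ∀ᶠ u : ℂ in 𝓝 0, ∀ i, 1 + u * lam i ≠ 0 :=
    eventually_all.2 fun i => ContinuousAt.eventually_ne (by fun_prop) (by simp)
  filter_upwards [eventually_nhdsWithin_of_eventually_nhds hne, self_mem_nhdsWithin] with u hu hu0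
  exact ⟨hu0, hu⟩

lemma eventually_curveZ_ne (hlam : 0 < lam) (hc : c ≠ 0) {p : ℂ} (hp : p ∈ regularSet lam)
    (w : ℂ) : ∀ᶠ u in 𝓝[≠] p, curveZ lam c u ≠ w := by
  refine ((analyticOnNhd_curveZ lam c p hp).eventually_eq_or_eventually_ne
    (analyticAt_const (v := w))).resolve_left fun hconst => ?_
  have heq : EqOn (curveZ lam c) (fun _ => w) (regularSet lam) :=
    (analyticOnNhd_curveZ lam c).eqOn_of_preconnected_of_eventuallyEq analyticOnNhd_const
      (isPreconnected_regularSet lam) hp hconst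
  have hlim : Tendsto (fun _ : ℂ => w) (𝓝[≠] 0) (Bornology.cobounded ℂ) :=
    (tendsto_curveZ_cobounded hlam hc).congr'
      (heq.eventuallyEq_of_mem (regularSet_mem_nhdsNE_zero lam))
  exact not_tendsto_nhds_of_tendsto_atTop (tendsto_norm_atTop_iff_cobounded.2 hlim) ‖w‖
    tendsto_const_nhds

lemma exists_isPreconnected_subset_of_mem_nhdsWithin {E : Type*} [NormedAddCommGroup E]
    [NormedSpace ℝ E] {f : E → ℂ} {s V : Set E} {x : E} (hs : Convex ℝ s)
    (hf : ContinuousOn f s) (hV : V ∈ 𝓝[s] x) :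
    ∃ V' ∈ 𝓝[s] x, V' ⊆ V ∧ IsPreconnected (f '' V') := by
  obtain ⟨δ, hδ, hball⟩ := Metric.mem_nhdsWithin_iff.1 hV
  exact ⟨_, Metric.mem_nhdsWithin_iff.2 ⟨δ, hδ, subset_rfl⟩, hball,
    ((convex_ball x δ).inter hs).isPreconnected.image f (hf.mono inter_subset_right)⟩

section SolutionFunctions

variable {T U : ℂ → ℂ}

lemma analyticAt_of_forall_isCurvePoint (h : ∀ z ∈ ℂ⁺, IsCurvePoint lam c z (T z) (U z))
    (hlam : 0 < lam) (hc : 0 < c) (hz : 0 < z.im) : AnalyticAt ℂ T z ∧ AnalyticAt ℂ U z := by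
  obtain ⟨T', U', hT', hU', -, -, hTU⟩ := (h z hz).exists_analyticAt hlam hc hz.le
  have hnhds := UpperHalfPlane.isOpen_upperHalfPlaneSet.mem_nhds hz
  constructor
  · refine hT'.congr ?_
    filter_upwards [hTU, hnhds] with w hw hw_im
    exact hw.t_unique (h w hw_im) hlam hc hw_im
  · refine hU'.congr ?_
    filter_upwards [hTU, hnhds] with w hw hw_im
    exact hw.u_unique (h w hw_im) hlam hc hw_im

lemma curveZ_eq_of_mapClusterPt (h : ∀ z ∈ ℂ⁺, IsCurvePoint lam c z (T z) (U z))
    (hlam : lam ≠ 0) (hc : c ≠ 0) {w p : ℂ} (hp : p ∈ regularSet lam)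
    (hcluster : MapClusterPt p (𝓝[ℂ⁺] w) U) : curveZ lam c p = w := by
  have hcont := (analyticOnNhd_curveZ lam c p hp).continuousAt
  have hZ : Tendsto (curveZ lam c ∘ U) (𝓝[ℂ⁺] w) (𝓝 w) :=
    (tendsto_id.mono_left nhdsWithin_le_nhds).congr' <|
      eventually_mem_nhdsWithin.mono fun z hz => ((h z hz).curveZ_eq hlam hc).symm
  exact eq_of_nhds_neBot ((hcluster.continuousAt_comp hcont).clusterPt.mono hZ)

theorem exists_tendsto_of_forall_isCurvePoint
    (h : ∀ z ∈ ℂ⁺, IsCurvePoint lam c z (T z) (U z)) (hlam : 0 < lam) (hc : 0 < c) {x : ℝ}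
    (hx : x ≠ 0) :
    ∃ p ∈ regularSet lam, Tendsto U (𝓝[ℂ⁺] (x : ℂ)) (𝓝 p) ∧
      Tendsto T (𝓝[ℂ⁺] (x : ℂ)) (𝓝 (-resolventMean lam p / x)) := by
  have hx0 : (x : ℂ) ≠ 0 := Complex.ofReal_ne_zero.2 hx
  obtain ⟨K, hK, hreg, hev⟩ := IsCurvePoint.exists_isCompact_forall_mem hlam hc hx0
  have hUK : ∀ᶠ z in 𝓝[ℂ⁺] (x : ℂ), U z ∈ K := by
    filter_upwards [eventually_nhdsWithin_of_eventually_nhds hev, self_mem_nhdsWithin] with z hz him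
    exact hz _ _ (le_of_lt him) (h z him)
  obtain ⟨p, hpK, hp⟩ := hK.exists_mapClusterPt (tendsto_principal.2 hUK)
  have hiso : ∀ᶠ q in 𝓝[≠] p, ¬ MapClusterPt q (𝓝[ℂ⁺] (x : ℂ)) U := by
    filter_upwards [eventually_curveZ_ne hlam hc.ne' (hreg hpK) x,
      nhdsWithin_le_nhds ((isOpen_regularSet lam).mem_nhds (hreg hpK))] with q hq hq_reg hcluster
    exact hq (curveZ_eq_of_mapClusterPt h hlam.ne' hc.ne' hq_reg hcluster)
  have hUcont : ContinuousOn U ℂ⁺ := fun z hz =>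
    (analyticAt_of_forall_isCurvePoint h hlam hc hz).2.continuousAt.continuousWithinAt
  have hU := tendsto_of_mapClusterPt_of_eventually_not_mapClusterPt hK hUK (fun V hV =>
    exists_isPreconnected_subset_of_mem_nhdsWithin (convex_halfSpace_im_gt 0) hUcont hV) hp hiso
  refine ⟨p, hreg hpK, hU, ?_⟩
  have hG := (hasDerivAt_resolventMean (hreg hpK).2).continuousAt.tendsto.comp hU
  refine (hG.neg.div (tendsto_id.mono_left nhdsWithin_le_nhds) hx0).congr' ?_
  exact eventually_mem_nhdsWithin.mono fun z hz => ((h z hz).t_eq hlam.ne').symm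

lemma isCurvePoint_of_tendsto (h : ∀ z ∈ ℂ⁺, IsCurvePoint lam c z (T z) (U z))
    (hlam : 0 < lam) (hc : 0 < c) {x : ℝ} (hx : x ≠ 0)
    (hT : Tendsto T (𝓝[ℂ⁺] (x : ℂ)) (𝓝 t)) (ht : 0 < t.im) :
    ∃ p, IsCurvePoint lam c x t p := by
  obtain ⟨p, hp, hU, hT'⟩ := exists_tendsto_of_forall_isCurvePoint h hlam hc hx
  have hxt : x * t = -resolventMean lam p := by
    rw [tendsto_nhds_unique hT hT', mul_div_cancel₀ _ (Complex.ofReal_ne_zero.2 hx)]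
  have him : 0 ≤ p.im := ge_of_tendsto ((Complex.continuous_im.tendsto p).comp hU)
    (eventually_mem_nhdsWithin.mono fun z hz => (h z hz).u_im_pos.le)
  have hct : (c * t : ℂ) ≠ 0 :=
    mul_ne_zero (Complex.ofReal_ne_zero.2 hc.ne') (ne_zero_of_im_pos ht)
  refine ⟨p, .of_im_nonneg hc him ht hxt (tendsto_nhds_unique (hU.inv₀ hp.1) ?_)⟩
  refine (((hT.const_mul (c : ℂ)).inv₀ hct).sub
    (((tendsto_id.mono_left nhdsWithin_le_nhds).mul hT).const_mul (c : ℂ))).congr' ?_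
  exact eventually_mem_nhdsWithin.mono fun z hz => (h z hz).inv_eq.symm

theorem exists_analyticAt_of_tendsto (h : ∀ z ∈ ℂ⁺, IsCurvePoint lam c z (T z) (U z))
    (hlam : 0 < lam) (hc : 0 < c) {x : ℝ} (hx : x ≠ 0)
    (hT : Tendsto T (𝓝[ℂ⁺] (x : ℂ)) (𝓝 t)) (ht : 0 < t.im) :
    ∃ T' : ℂ → ℂ, AnalyticAt ℂ T' x ∧ ∀ᶠ z in 𝓝 (x : ℂ), 0 < z.im → T z = T' z := by
  obtain ⟨p, hp⟩ := isCurvePoint_of_tendsto h hlam hc hx hT ht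
  obtain ⟨T', U', hT', -, -, -, hTU⟩ := hp.exists_analyticAt hlam hc (Complex.ofReal_im x).ge
  exact ⟨T', hT', hTU.mono fun z hz him => (h z him).t_unique hz hlam hc him⟩

end SolutionFunctions

end CanonicalCurve

section AnalyticBoundaryValues

variable {T T' : ℂ → ℂ} {τ : ℝ → ℂ} {x₀ : ℝ}

lemma analyticAt_of_tendsto_upperHalfPlane
    (hlim : ∀ᶠ x : ℝ in 𝓝 x₀, Tendsto T (𝓝[ℂ⁺] (x : ℂ)) (𝓝 (τ x))) (hT' : AnalyticAt ℂ T' x₀)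
    (hTT' : ∀ᶠ z in 𝓝 (x₀ : ℂ), 0 < z.im → T z = T' z) : AnalyticAt ℝ τ x₀ := by
  have hreal : Tendsto Complex.ofReal (𝓝 x₀) (𝓝 (x₀ : ℂ)) := Complex.continuous_ofReal.tendsto x₀
  refine ((hT'.restrictScalars (𝕜 := ℝ)).fun_comp (Complex.ofRealCLM.analyticAt x₀)).congr ?_
  filter_upwards [hlim, hreal.eventually hTT'.eventually_nhds,
    hreal.eventually hT'.eventually_analyticAt] with x hx heq hxT'
  refine (tendsto_nhds_unique hx ?_).symm
  refine (hxT'.continuousAt.tendsto.mono_left nhdsWithin_le_nhds).congr' ?_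
  filter_upwards [eventually_nhdsWithin_of_eventually_nhds heq, self_mem_nhdsWithin] with z hz him
  exact (hz him).symm

lemma exists_hasSum_of_analyticAt (hτ : AnalyticAt ℝ τ x₀) :
    ∃ (a : ℕ → ℂ) (ε : ℝ), 0 < ε ∧ ∀ x : ℝ, |x - x₀| < ε →
      HasSum (fun k => a k * ((x : ℂ) - (x₀ : ℂ)) ^ k) (τ x) := by
  obtain ⟨p, hp⟩ := hτ
  obtain ⟨ε, hε, hsum⟩ := Metric.eventually_nhds_iff.1 (hasFPowerSeriesAt_iff'.1 hp)
  refine ⟨p.coeff, ε, hε, fun x hx => (hsum hx).congr_fun fun k => ?_⟩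
  rw [Complex.real_smul, Complex.ofReal_pow, Complex.ofReal_sub, mul_comm]

lemma hasSum_im_of_hasSum {a : ℕ → ℂ} {x : ℝ} {s : ℂ}
    (h : HasSum (fun k => a k * ((x : ℂ) - (x₀ : ℂ)) ^ k) s) :
    HasSum (fun k => (a k).im * (x - x₀) ^ k) s.im := by
  refine (Complex.hasSum_im h).congr_fun fun k => ?_
  rw [← Complex.ofReal_sub, ← Complex.ofReal_pow, Complex.im_mul_ofReal]

end AnalyticBoundaryValues

/-! ### The canonical equation -/

section CanonicalEquation

variable {M : ℕ} {R : Matrix (Fin M) (Fin M) ℂ} {c x : ℝ}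

lemma eigenvalues_pos_of_ne_zero (hR : R.PosSemidef) (hR0 : R ≠ 0) : 0 < hR.1.eigenvalues :=
  lt_of_le_of_ne hR.eigenvalues_nonneg fun h => hR0 (hR.1.eigenvalues_eq_zero_iff.1 h.symm)

lemma isCanonicalSolution_canonicalT (hR : R.PosSemidef) (hR0 : R ≠ 0) (hc : 0 < c) {z : ℂ}
    (hz : 0 < z.im) : IsCanonicalSolution R c z (canonicalT R c z) := by
  have hlam := eigenvalues_pos_of_ne_zero hR hR0
  have hex : ∃ s, IsCanonicalSolution R c z s :=
    (exists_isCurvePoint hlam hc hz).imp fun s => (isCanonicalSolution_iff hR.1 hlam.ne' hc).2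
  rw [canonicalT, dif_pos hex]
  exact hex.choose_spec

lemma isCanonicalSolution_unique (hR : R.PosSemidef) (hR0 : R ≠ 0) (hc : 0 < c) {z s t : ℂ}
    (hz : 0 < z.im) (hs : IsCanonicalSolution R c z s) (ht : IsCanonicalSolution R c z t) :
    s = t := by
  have hlam := eigenvalues_pos_of_ne_zero hR hR0
  obtain ⟨u, hu⟩ := (isCanonicalSolution_iff hR.1 hlam.ne' hc).1 hs
  obtain ⟨v, hv⟩ := (isCanonicalSolution_iff hR.1 hlam.ne' hc).1 ht
  exact hu.t_unique hv hlam hc hz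

lemma exists_forall_isCurvePoint_canonicalT (hR : R.PosSemidef) (hR0 : R ≠ 0) (hc : 0 < c) :
    ∃ U : ℂ → ℂ, ∀ z ∈ ℂ⁺, IsCurvePoint hR.1.eigenvalues c z (canonicalT R c z) (U z) := by
  have hlam := eigenvalues_pos_of_ne_zero hR hR0
  choose! U hU using fun z (hz : z ∈ ℂ⁺) =>
    (isCanonicalSolution_iff hR.1 hlam.ne' hc).1 (isCanonicalSolution_canonicalT hR hR0 hc hz)
  exact ⟨U, hU⟩

lemma differentiableOn_canonicalT (hR : R.PosSemidef) (hR0 : R ≠ 0) (hc : 0 < c) :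
    DifferentiableOn ℂ (canonicalT R c) ℂ⁺ := by
  obtain ⟨U, hU⟩ := exists_forall_isCurvePoint_canonicalT hR hR0 hc
  exact fun z hz => (analyticAt_of_forall_isCurvePoint hU (eigenvalues_pos_of_ne_zero hR hR0) hc
    hz).1.differentiableAt.differentiableWithinAt

lemma tendsto_boundaryT (hR : R.PosSemidef) (hR0 : R ≠ 0) (hc : 0 < c) (hx : x ≠ 0) :
    Tendsto (canonicalT R c) (𝓝[ℂ⁺] (x : ℂ)) (𝓝 (boundaryT R c x)) := by
  obtain ⟨U, hU⟩ := exists_forall_isCurvePoint_canonicalT hR hR0 hc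
  obtain ⟨p, -, -, hlim⟩ :=
    exists_tendsto_of_forall_isCurvePoint hU (eigenvalues_pos_of_ne_zero hR hR0) hc hx
  exact tendsto_nhds_limUnder ⟨_, hlim⟩

lemma tendsto_im_boundaryT (hR : R.PosSemidef) (hR0 : R ≠ 0) (hc : 0 < c) (hx : x ≠ 0) :
    Tendsto (fun z => (canonicalT R c z).im) (𝓝[ℂ⁺] (x : ℂ)) (𝓝 (boundaryT R c x).im) :=
  (Complex.continuous_im.tendsto _).comp (tendsto_boundaryT hR hR0 hc hx)

lemma im_boundaryT_nonneg (hR : R.PosSemidef) (hR0 : R ≠ 0) (hc : 0 < c) (hx : x ≠ 0) :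
    0 ≤ (boundaryT R c x).im :=
  ge_of_tendsto (tendsto_im_boundaryT hR hR0 hc hx) <| eventually_mem_nhdsWithin.mono
    fun _ hz => (isCanonicalSolution_canonicalT hR hR0 hc hz).1.le

-- On the negative axis, `Im (z t(z)) > 0` becomes `x Im t(x) ≥ 0` in the limit.
lemma im_boundaryT_of_neg (hR : R.PosSemidef) (hR0 : R ≠ 0) (hc : 0 < c) (hx : x < 0) :
    (boundaryT R c x).im = 0 := by
  have hlim : Tendsto (fun z => (z * canonicalT R c z).im) (𝓝[ℂ⁺] (x : ℂ))
      (𝓝 (x * boundaryT R c x).im) :=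
    (Complex.continuous_im.tendsto _).comp <|
      (tendsto_id.mono_left nhdsWithin_le_nhds).mul (tendsto_boundaryT hR hR0 hc hx.ne)
  have hmul : 0 ≤ ((x : ℂ) * boundaryT R c x).im :=
    ge_of_tendsto hlim <| eventually_mem_nhdsWithin.mono
      fun _ hz => (isCanonicalSolution_canonicalT hR hR0 hc hz).2.1.le
  rw [Complex.im_ofReal_mul] at hmul
  exact le_antisymm (nonpos_of_mul_nonneg_right hmul hx) (im_boundaryT_nonneg hR hR0 hc hx.ne)

lemma restrict_eq_withDensity_densityF (hR : R.PosSemidef) (hR0 : R ≠ 0) (hc : 0 < c)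
    {μ : Measure ℝ} [IsFiniteMeasure μ] (hμ : ∀ z ∈ ℂ⁺, resolventTransform μ z = canonicalT R c z)
    {V : Set ℝ} (hV : IsOpen V) (hV0 : (0 : ℝ) ∉ V) :
    μ.restrict V = (volume.restrict V).withDensity fun x => ENNReal.ofReal (densityF R c x) :=
  restrict_eq_withDensity_of_tendsto hV fun x hx =>
    (tendsto_im_boundaryT hR hR0 hc (ne_of_mem_of_not_mem hx hV0)).congr' <|
      eventually_mem_nhdsWithin.mono fun z hz => by simp only [hμ z hz]

lemma measure_Iio_zero_of_resolventTransform_eq (hR : R.PosSemidef) (hR0 : R ≠ 0) (hc : 0 < c)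
    {μ : Measure ℝ} [IsFiniteMeasure μ]
    (hμ : ∀ z ∈ ℂ⁺, resolventTransform μ z = canonicalT R c z) : μ (Iio 0) = 0 := by
  rw [measure_eq_setLIntegral_of_subset (restrict_eq_withDensity_densityF hR hR0 hc hμ isOpen_Iio
    self_notMem_Iio) isOpen_Iio subset_rfl]
  refine setLIntegral_eq_zero measurableSet_Iio fun x hx => ?_
  simp [densityF, im_boundaryT_of_neg hR hR0 hc hx]

theorem isStieltjesMeasure_canonicalMeasure (hR : R.PosSemidef) (hR0 : R ≠ 0) (hc : 0 < c) :
    IsStieltjesMeasure (canonicalMeasure R c) (canonicalT R c) := by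
  have hex : ∃ μ : Measure ℝ, IsStieltjesMeasure μ (canonicalT R c) := by
    obtain ⟨U, hU⟩ := exists_forall_isCurvePoint_canonicalT hR hR0 hc
    obtain ⟨C, hC⟩ :=
      IsCurvePoint.exists_norm_mul_t_le (eigenvalues_pos_of_ne_zero hR hR0) hc
    obtain ⟨μ, hfin, hμ⟩ := exists_measure_resolventTransform_eq
      (differentiableOn_canonicalT hR hR0 hc) (fun z hz => (hU z hz).t_im_pos.le) fun y hy => by
        have hy_mem : (y * Complex.I : ℂ) ∈ ℂ⁺ := by simpa using hy
        simpa [abs_of_pos hy] using hC _ _ _ (le_of_lt hy_mem) (hU _ hy_mem)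
    exact ⟨μ, hfin, measure_Iio_zero_of_resolventTransform_eq hR hR0 hc hμ, hμ⟩
  rw [canonicalMeasure, dif_pos hex]
  exact hex.choose_spec

theorem restrict_canonicalMeasure (hR : R.PosSemidef) (hR0 : R ≠ 0) (hc : 0 < c) :
    (canonicalMeasure R c).restrict (Ioi 0) =
      (volume.restrict (Ioi 0)).withDensity fun x => ENNReal.ofReal (densityF R c x) := by
  obtain ⟨hfin, -, hμ⟩ := isStieltjesMeasure_canonicalMeasure hR hR0 hc
  exact restrict_eq_withDensity_densityF hR hR0 hc hμ isOpen_Ioi self_notMem_Ioi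

theorem continuousOn_densityF (hR : R.PosSemidef) (hR0 : R ≠ 0) (hc : 0 < c) :
    ContinuousOn (densityF R c) (Ioi 0) :=
  continuousOn_const.mul <| Complex.continuous_im.comp_continuousOn <|
    continuousOn_of_tendsto_upperHalfPlane fun _ hx =>
      tendsto_boundaryT hR hR0 hc (ne_of_gt hx)

theorem analyticAt_boundaryT (hR : R.PosSemidef) (hR0 : R ≠ 0) (hc : 0 < c) (hx : x ≠ 0)
    (him : 0 < (boundaryT R c x).im) : AnalyticAt ℝ (boundaryT R c) x := by
  obtain ⟨U, hU⟩ := exists_forall_isCurvePoint_canonicalT hR hR0 hc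
  obtain ⟨T', hT', hTT'⟩ := exists_analyticAt_of_tendsto hU (eigenvalues_pos_of_ne_zero hR hR0)
    hc hx (tendsto_boundaryT hR hR0 hc hx) him
  exact analyticAt_of_tendsto_upperHalfPlane
    ((eventually_ne_nhds hx).mono fun _ => tendsto_boundaryT hR hR0 hc) hT' hTT'

theorem exists_hasSum_boundaryT_densityF (hR : R.PosSemidef) (hR0 : R ≠ 0) (hc : 0 < c)
    (hx : x ≠ 0) (him : 0 < (boundaryT R c x).im) :
    ∃ (a : ℕ → ℂ) (b : ℕ → ℝ) (ε : ℝ), 0 < ε ∧ ∀ y : ℝ, |y - x| < ε →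
      HasSum (fun k => a k * ((y : ℂ) - (x : ℂ)) ^ k) (boundaryT R c y) ∧
      HasSum (fun k => b k * (y - x) ^ k) (densityF R c y) := by
  obtain ⟨a, ε, hε, hsum⟩ := exists_hasSum_of_analyticAt (analyticAt_boundaryT hR hR0 hc hx him)
  refine ⟨a, fun k => 1 / Real.pi * (a k).im, ε, hε, fun y hy => ⟨hsum y hy, ?_⟩⟩
  simpa only [mul_assoc, densityF] using
    (hasSum_im_of_hasSum (hsum y hy)).mul_left (1 / Real.pi)

theorem analyticOnNhd_densityF (hR : R.PosSemidef) (hR0 : R ≠ 0) (hc : 0 < c) :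
    AnalyticOnNhd ℝ (densityF R c) (bulkSet R c) := fun _ hx =>
  analyticAt_const.fun_mul <| (Complex.imCLM.analyticAt _).fun_comp <|
    analyticAt_boundaryT hR hR0 hc (ne_of_gt hx.1) hx.2

lemma bulkSet_eq_setOf_densityF_pos (R : Matrix (Fin M) (Fin M) ℂ) (c : ℝ) :
    bulkSet R c = {x ∈ Ioi 0 | 0 < densityF R c x} := by
  ext x
  simp only [bulkSet, densityF, mem_ofPred_eq, mem_Ioi, one_div,
    mul_pos_iff_of_pos_left (inv_pos.2 Real.pi_pos)]

lemma support_canonicalMeasure_subset (hR : R.PosSemidef) (hR0 : R ≠ 0) (hc : 0 < c) :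
    (canonicalMeasure R c).support ⊆ Ici 0 := by
  rw [← compl_Iio]
  exact subset_compl_comm.1 <| Measure.subset_compl_support_of_isOpen isOpen_Iio
    (isStieltjesMeasure_canonicalMeasure hR hR0 hc).2.1

lemma interior_support_canonicalMeasure_subset (hR : R.PosSemidef) (hR0 : R ≠ 0) (hc : 0 < c) :
    interior (canonicalMeasure R c).support ⊆ Ioi 0 :=
  (interior_mono (support_canonicalMeasure_subset hR hR0 hc)).trans interior_Ici.subset

lemma isOpen_bulkSet (hR : R.PosSemidef) (hR0 : R ≠ 0) (hc : 0 < c) : IsOpen (bulkSet R c) := by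
  rw [bulkSet_eq_setOf_densityF_pos]
  exact (continuousOn_densityF hR hR0 hc).isOpen_inter_preimage isOpen_Ioi isOpen_Ioi

lemma bulkSet_subset_interior_support (hR : R.PosSemidef) (hR0 : R ≠ 0) (hc : 0 < c) :
    bulkSet R c ⊆ interior (canonicalMeasure R c).support := by
  refine interior_maximal ?_ (isOpen_bulkSet hR hR0 hc)
  rw [bulkSet_eq_setOf_densityF_pos]
  exact setOf_pos_subset_support isOpen_Ioi (continuousOn_densityF hR hR0 hc)
    (restrict_canonicalMeasure hR hR0 hc)

theorem bulkSet_eq_interior_support_inter_ne_zero (hR : R.PosSemidef) (hR0 : R ≠ 0)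
    (hc : 0 < c) :
    bulkSet R c = {x ∈ interior (canonicalMeasure R c).support | densityF R c x ≠ 0} := by
  ext x
  constructor
  · intro hx
    refine ⟨bulkSet_subset_interior_support hR hR0 hc hx, ?_⟩
    rw [bulkSet_eq_setOf_densityF_pos] at hx
    exact hx.2.ne'
  · rintro ⟨hx, hne⟩
    have hx0 : 0 < x := interior_support_canonicalMeasure_subset hR hR0 hc hx
    exact ⟨hx0, (im_boundaryT_nonneg hR hR0 hc hx0.ne').lt_of_ne' (right_ne_zero_of_mul hne)⟩

theorem interior_support_subset_closure_bulkSet (hR : R.PosSemidef) (hR0 : R ≠ 0) (hc : 0 < c) :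
    interior (canonicalMeasure R c).support ⊆ closure (bulkSet R c) := by
  rw [bulkSet_eq_setOf_densityF_pos]
  exact (subset_inter interior_subset (interior_support_canonicalMeasure_subset hR hR0 hc)).trans
    (support_inter_subset_closure_setOf_pos isOpen_Ioi (restrict_canonicalMeasure hR hR0 hc))

end CanonicalEquation

theorem mainTheorem12_general {M : ℕ} (R : Matrix (Fin M) (Fin M) ℂ)
    (hR : R.PosSemidef) (hR0 : R ≠ 0) (c : ℝ) (hc : 0 < c) :
    (∀ z : ℂ, 0 < z.im → IsCanonicalSolution R c z (canonicalT R c z) ∧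
      ∀ s : ℂ, IsCanonicalSolution R c z s → s = canonicalT R c z) ∧
    IsStieltjesMeasure (canonicalMeasure R c) (canonicalT R c) ∧
    (∀ x : ℝ, 0 < x →
      Tendsto (canonicalT R c) (𝓝[{z : ℂ | 0 < z.im}] (x : ℂ)) (𝓝 (boundaryT R c x))) ∧
    ContinuousOn (densityF R c) (Ioi 0) ∧
    (canonicalMeasure R c).restrict (Ioi 0) =
      (volume.restrict (Ioi 0)).withDensity (fun x => ENNReal.ofReal (densityF R c x)) ∧
    (∀ x₀ : ℝ, 0 < x₀ → 0 < (boundaryT R c x₀).im →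
      ∃ (a : ℕ → ℂ) (b : ℕ → ℝ) (ε : ℝ), 0 < ε ∧ ∀ x : ℝ, |x - x₀| < ε →
        HasSum (fun k : ℕ => a k * ((x : ℂ) - (x₀ : ℂ)) ^ k) (boundaryT R c x) ∧
        HasSum (fun k : ℕ => b k * (x - x₀) ^ k) (densityF R c x)) ∧
    AnalyticOnNhd ℝ (densityF R c) (bulkSet R c) ∧
    bulkSet R c = {x ∈ interior (canonicalMeasure R c).support | densityF R c x ≠ 0} ∧
    interior (canonicalMeasure R c).support ⊆ closure (bulkSet R c) :=
  ⟨fun _ hz => ⟨isCanonicalSolution_canonicalT hR hR0 hc hz, fun _ hs =>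
      isCanonicalSolution_unique hR hR0 hc hz hs (isCanonicalSolution_canonicalT hR hR0 hc hz)⟩,
    isStieltjesMeasure_canonicalMeasure hR hR0 hc,
    fun _ hx => tendsto_boundaryT hR hR0 hc hx.ne',
    continuousOn_densityF hR hR0 hc,
    restrict_canonicalMeasure hR hR0 hc,
    fun _ hx₀ => exists_hasSum_boundaryT_densityF hR hR0 hc hx₀.ne',
    analyticOnNhd_densityF hR hR0 hc,
    bulkSet_eq_interior_support_inter_ne_zero hR hR0 hc,
    interior_support_subset_closure_bulkSet hR hR0 hc⟩

end

theorem mainTheorem12 {M : ℕ} (hM : 0 < M) (R : Matrix (Fin M) (Fin M) ℂ) (hR : R.PosDef)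
    (c : ℝ) (hc : 0 < c) :
    -- `t(z)` is the unique solution of the canonical equation, for every `z` in `ℂ⁺`
    (∀ z : ℂ, 0 < z.im → IsCanonicalSolution R c z (canonicalT R c z) ∧
      ∀ s : ℂ, IsCanonicalSolution R c z s → s = canonicalT R c z) ∧
    -- `t` is the Stieltjes transform of the finite measure `μ`, carried by `[0, ∞)`
    IsStieltjesMeasure (canonicalMeasure R c) (canonicalT R c) ∧
    -- the limit `t(x)` exists for every `x > 0`
    (∀ x : ℝ, 0 < x →
      Tendsto (canonicalT R c) (𝓝[{z : ℂ | 0 < z.im}] (x : ℂ)) (𝓝 (boundaryT R c x))) ∧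
    -- `f` is the (continuous) density of `μ` on `(0, ∞)`
    ContinuousOn (densityF R c) (Ioi 0) ∧
    (canonicalMeasure R c).restrict (Ioi 0) =
      (volume.restrict (Ioi 0)).withDensity (fun x => ENNReal.ofReal (densityF R c x)) ∧
    -- power series expansions of `t` and `f` around `x₀`
    (∀ x₀ : ℝ, 0 < x₀ → 0 < (boundaryT R c x₀).im →
      ∃ (a : ℕ → ℂ) (b : ℕ → ℝ) (ε : ℝ), 0 < ε ∧ ∀ x : ℝ, |x - x₀| < ε →
        HasSum (fun k : ℕ => a k * ((x : ℂ) - (x₀ : ℂ)) ^ k) (boundaryT R c x) ∧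
        HasSum (fun k : ℕ => b k * (x - x₀) ^ k) (densityF R c x)) ∧
    -- real analyticity of the density, and the place of the analyticity set in the support
    AnalyticOnNhd ℝ (densityF R c) (bulkSet R c) ∧
    bulkSet R c = {x ∈ interior (canonicalMeasure R c).support | densityF R c x ≠ 0} ∧
    interior (canonicalMeasure R c).support ⊆ closure (bulkSet R c) :=
  have : Nonempty (Fin M) := Fin.pos_iff_nonempty.1 hM
  mainTheorem12_general R hR.posSemidef hR.isUnit.ne_zero c hc
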